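/- **Setting.** Let $I=[0,1]$, let $R$ be the anti-clockwise rotation of $\mathbb R^2$ by $\pi/2$, and write $\langle\cdot,\cdot\rangle$, $|\cdot|$ for the Euclidean scalar product and norm. For a curve $\gamma$ let $L_\gamma$ be its length and $\kappa_\gamma=\langle\gamma_{ss},R\gamma_s\rangle/|\gamma_s|^3$ its curvature. Let $$\mathcal{AC}=\{\gamma\in H^2(I;\mathbb R^2): |\gamma_s|\equiv \mathrm{const}=L_\gamma,\ \gamma(0)\neq\gamma(1)\},\qquad \mathcal{AC}_{\tilde\gamma}=\{\gamma\in\mathcal{AC}:\langle\gamma_s,\tilde\gamma_s\rangle\ge 0 \text{ on } I\}.$$ Fix $\varepsilon>0$ and set, for $\gamma,\tilde\gamma\in\mathcal{AC}$, $$\mathcal E(\gamma)=L_\gamma+\frac{\varepsilon}{2}\int_\gamma\kappa_\gamma^2\,d\mathcal H^1-\log|\gamma(1)-\gamma(0)|,$$ $$\mathcal D(\gamma,\tilde\gamma)=\frac1{4L_{\tilde\gamma}}\int_0^1\langle\gamma-\tilde\gamma,R\tilde\gamma_s\rangle^2ds+\frac1{4L_\gamma}\int_0^1\langle\gamma-\tilde\gamma,R\gamma_s\rangle^2ds+\tfrac12|\gamma(0)-\tilde\gamma(0)|^2+\tfrac12|\gamma(1)-\tilde\gamma(1)|^2.$$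 Fix $\gamma_0\in\mathcal{AC}$. For $\tau>0$ a sequence of step-by-step minimizers is a sequence $(\gamma^\tau_n)_{n\ge0}$ with $\gamma_0^\tau=\gamma_0$ and $$\gamma^\tau_{n+1}\in\operatorname*{argmin}_{\gamma\in\mathcal{AC}_{\gamma^\tau_n}}\Big\{\mathcal E(\gamma)+\frac1\tau\mathcal D(\gamma,\gamma^\tau_n)\Big\}\qquad(n\ge 0).$$ Put $\gamma^\tau(t)=\gamma^\tau_{\lceil t/\tau\rceil}$ and $\tilde\gamma^\tau(t)=\gamma^\tau(t-\tau)$, with $\gamma^\tau(t)=\gamma_0$ for $t\le0$. For $\gamma,\tilde\gamma\in\mathcal{AC}$ and $\eta\in C^\infty(I;\mathbb R^2)$ let $v=(\gamma-\tilde\gamma)/\tau$, $$P_1(s)=\frac1{L_\gamma^2}\Big(s\int_0^1\langle\gamma_s,\eta_s\rangle\,d\tilde s-\int_0^s\langle\gamma_s,\eta_s\rangle\,d\tilde s\Big),\qquad P_2(s)=\frac1{L_\gamma^2}\Big(\int_0^1\langle\gamma_s,\eta_s\rangle\,d\tilde s-\langle\gamma_s(s),\eta_s(s)\rangle\Big),$$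 and define $$E(\gamma,\eta)=\int_0^1\frac{\varepsilon}{L_\gamma^3}\langle\gamma_{ss},\eta_{ss}\rangle+\frac1{L_\gamma}\Big(1-\frac{3\varepsilon}2\kappa_\gamma^2\Big)\langle\gamma_s,\eta_s\rangle\,ds-\Big\langle\frac{\gamma(1)-\gamma(0)}{|\gamma(1)-\gamma(0)|^2},\eta(1)-\eta(0)\Big\rangle,$$ $$D(\gamma,\tilde\gamma,\eta)=\frac1{2L_{\tilde\gamma}}\int_0^1\langle v,R\tilde\gamma_s\rangle\langle R\tilde\gamma_s,\eta\rangle\,ds+\frac1{2L_\gamma}\int_0^1\langle v,R\gamma_s\rangle\langle R\gamma_s,\eta\rangle\,ds+\langle v(0),\eta(0)\rangle+\langle v(1),\eta(1)\rangle,$$ $$\begin{aligned}\mathrm{Err}(\gamma,\tilde\gamma,\eta)={}&\frac1{2L_{\tilde\gamma}}\int_0^1\langle v,R\tilde\gamma_s\rangle\langle R\tilde\gamma_s,P_1\gamma_s\rangle\,ds+\frac1{2L_\gamma}\int_0^1\langle v,R\gamma_s\rangle\langle\gamma-\tilde\gamma,\,P_1R\gamma_{ss}+P_2R\gamma_s+R\eta_s\rangle\,ds\\&-\frac1{4L_\gamma^3}\int_0^1\langle\gamma_s,\eta_s\rangle\,ds\int_0^1\langle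 v,R\gamma_s\rangle\langle\gamma-\tilde\gamma,R\gamma_s\rangle\,ds.\end{aligned}$$ **Theorem (time-discrete geometric evolution).** For every $\varepsilon>0$, $\gamma_0\in\mathcal{AC}$ and $T>0$ there is $\tau_0=\tau_0(\varepsilon,T)>0$ (which may also depend on the fixed initial curve $\gamma_0$) such that for every $0<\tau<\tau_0$, every sequence of step-by-step minimizers $(\gamma^\tau_n)_n$ with time step $\tau$ and initial curve $\gamma_0$, and every $\eta\in C^\infty([0,\infty);C^\infty(I;\mathbb R^2))$, the following integrand is integrable on $(0,T)$ and $$\int_0^T E(\gamma^\tau(t),\eta(t))+D(\gamma^\tau(t),\tilde\gamma^\tau(t),\eta(t))+\mathrm{Err}(\gamma^\tau(t),\tilde\gamma^\tau(t),\eta(t))\,dt=0.$$ -/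

import Mathlib

open Set MeasureTheory
open scoped ContDiff RealInnerProductSpace

namespace ElasticFlow

/-- The Euclidean plane. -/
abbrev Plane : Type := EuclideanSpace ℝ (Fin 2)

/-- The parameter interval `I = [0, 1]`. Curves are functions `ℝ → Plane` of which only the values
on `I` matter: every notion below depends only on the restriction to `I`. -/
abbrev I : Set ℝ := Icc 0 1

/-- Anti-clockwise rotation of the plane by `π / 2`. -/
noncomputable def rot (a : Plane) : Plane := !₂[-(a 1), a 0]

/-- Derivative in the curve parameter `s ∈ I` (one-sided at the endpoints). -/
noncomputable def ds (γ : ℝ → Plane) : ℝ → Plane := derivWithin γ I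

/-- `γ ∈ H²(I; ℝ²)`, for the continuous representative: `γ` is `C¹` on `I`, its derivative `γ_s` is
absolutely continuous on `I`, and the second derivative `γ_ss` (which then exists almost everywhere
and is the weak second derivative) is in `L²`. -/
def MemH2 (γ : ℝ → Plane) : Prop :=
  ContDiffOn ℝ 1 γ I ∧ AbsolutelyContinuousOnInterval (ds γ) 0 1 ∧
    MemLp (ds (ds γ)) 2 (volume.restrict I)

/-- Length of a curve. -/
noncomputable def length (γ : ℝ → Plane) : ℝ := ∫ s in (0 : ℝ)..1, ‖ds γ s‖

/-- Signed curvature of an immersed curve, `⟨γ_ss, R γ_s⟩ / |γ_s|³`. -/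
noncomputable def curvature (γ : ℝ → Plane) (s : ℝ) : ℝ :=
  ⟪ds (ds γ) s, rot (ds γ s)⟫ / ‖ds γ s‖ ^ 3

/-- The class `AC` of admissible curves: `H²` curves of constant speed with distinct endpoints. -/
def AC : Set (ℝ → Plane) :=
  {γ | MemH2 γ ∧ (∀ s ∈ I, ‖ds γ s‖ = length γ) ∧ γ 0 ≠ γ 1}

/-- The admissible curves that satisfy the angle constraint with respect to `γ'`. -/
def ACAngle (γ' : ℝ → Plane) : Set (ℝ → Plane) :=
  {γ | γ ∈ AC ∧ ∀ s ∈ I, 0 ≤ ⟪ds γ s, ds γ' s⟫}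

/-- The energy `L_γ + (ε / 2) ∫_γ κ² dH¹ - log |γ(1) - γ(0)|`. -/
noncomputable def energy (ε : ℝ) (γ : ℝ → Plane) : ℝ :=
  length γ + ε / 2 * (∫ s in (0 : ℝ)..1, curvature γ s ^ 2 * ‖ds γ s‖) - Real.log ‖γ 1 - γ 0‖

/-- The dissipation of a step from `γ'` to `γ`. -/
noncomputable def dissipation (γ γ' : ℝ → Plane) : ℝ :=
  1 / (4 * length γ') * (∫ s in (0 : ℝ)..1, ⟪γ s - γ' s, rot (ds γ' s)⟫ ^ 2) +
    1 / (4 * length γ) * (∫ s in (0 : ℝ)..1, ⟪γ s - γ' s, rot (ds γ s)⟫ ^ 2) +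
    1 / 2 * ‖γ 0 - γ' 0‖ ^ 2 + 1 / 2 * ‖γ 1 - γ' 1‖ ^ 2

/-- The functional minimized in each step. -/
noncomputable def stepFunctional (ε τ : ℝ) (γ γ' : ℝ → Plane) : ℝ :=
  energy ε γ + 1 / τ * dissipation γ γ'

/-- `c` is a sequence of step-by-step minimizers with time step `τ` and initial curve `γ₀`. -/
def IsStepMinimizers (ε τ : ℝ) (γ₀ : ℝ → Plane) (c : ℕ → ℝ → Plane) : Prop :=
  c 0 = γ₀ ∧ ∀ n : ℕ, c (n + 1) ∈ ACAngle (c n) ∧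
    IsMinOn (fun γ => stepFunctional ε τ γ (c n)) (ACAngle (c n)) (c (n + 1))

/-- The piecewise constant interpolation `t ↦ c ⌈t / τ⌉` (constant `c 0` for `t ≤ 0`). -/
noncomputable def interp (τ : ℝ) (c : ℕ → ℝ → Plane) (t : ℝ) : ℝ → Plane := c ⌈t / τ⌉₊

/-- The coefficient `P₁(γ, η)`. -/
noncomputable def P₁ (γ η : ℝ → Plane) (s : ℝ) : ℝ :=
  1 / length γ ^ 2 *
    (s * (∫ r in (0 : ℝ)..1, ⟪ds γ r, ds η r⟫) - ∫ r in (0 : ℝ)..s, ⟪ds γ r, ds η r⟫)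

/-- The coefficient `P₂(γ, η)`. -/
noncomputable def P₂ (γ η : ℝ → Plane) (s : ℝ) : ℝ :=
  1 / length γ ^ 2 * ((∫ r in (0 : ℝ)..1, ⟪ds γ r, ds η r⟫) - ⟪ds γ s, ds η s⟫)

/-- The energy part `E(γ, η)` of the weak Euler-Lagrange identity. -/
noncomputable def energyTerm (ε : ℝ) (γ η : ℝ → Plane) : ℝ :=
  (∫ s in (0 : ℝ)..1, (ε / length γ ^ 3 * ⟪ds (ds γ) s, ds (ds η) s⟫ +
      1 / length γ * (1 - 3 * ε / 2 * curvature γ s ^ 2) * ⟪ds γ s, ds η s⟫)) -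
    ⟪(1 / ‖γ 1 - γ 0‖ ^ 2) • (γ 1 - γ 0), η 1 - η 0⟫

/-- The discrete velocity `(γ - γ') / τ`. -/
noncomputable def vel (τ : ℝ) (γ γ' : ℝ → Plane) (s : ℝ) : Plane := (1 / τ) • (γ s - γ' s)

/-- The dissipation part `D(γ, η)` of the weak Euler-Lagrange identity, `γ'` being the curve of
the previous time step. -/
noncomputable def dissipationTerm (τ : ℝ) (γ γ' η : ℝ → Plane) : ℝ :=
  1 / (2 * length γ') *
      (∫ s in (0 : ℝ)..1, ⟪vel τ γ γ' s, rot (ds γ' s)⟫ * ⟪rot (ds γ' s), η s⟫) +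
    1 / (2 * length γ) *
      (∫ s in (0 : ℝ)..1, ⟪vel τ γ γ' s, rot (ds γ s)⟫ * ⟪rot (ds γ s), η s⟫) +
    ⟪vel τ γ γ' 0, η 0⟫ + ⟪vel τ γ γ' 1, η 1⟫

/-- The error part `Err(γ, η)` of the weak Euler-Lagrange identity, `γ'` being the curve of the
previous time step. -/
noncomputable def errorTerm (τ : ℝ) (γ γ' η : ℝ → Plane) : ℝ :=
  1 / (2 * length γ') *
      (∫ s in (0 : ℝ)..1,
        ⟪vel τ γ γ' s, rot (ds γ' s)⟫ * ⟪rot (ds γ' s), P₁ γ η s • ds γ s⟫) +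
    1 / (2 * length γ) *
      (∫ s in (0 : ℝ)..1, ⟪vel τ γ γ' s, rot (ds γ s)⟫ *
        ⟪γ s - γ' s,
          P₁ γ η s • rot (ds (ds γ) s) + P₂ γ η s • rot (ds γ s) + rot (ds η s)⟫) -
    1 / (4 * length γ ^ 3) * (∫ s in (0 : ℝ)..1, ⟪ds γ s, ds η s⟫) *
      (∫ s in (0 : ℝ)..1, ⟪vel τ γ γ' s, rot (ds γ s)⟫ * ⟪γ s - γ' s, rot (ds γ s)⟫)

/-- The integrand `E + D + Err` at time `t`, for the piecewise constant flow `interp τ c`, its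
translation in time `interp τ c (t - τ)` and the test function `η t`. -/
noncomputable def eulerLagrange (ε τ : ℝ) (c : ℕ → ℝ → Plane) (η : ℝ → ℝ → Plane) (t : ℝ) : ℝ :=
  energyTerm ε (interp τ c t) (η t) +
    dissipationTerm τ (interp τ c t) (interp τ c (t - τ)) (η t) +
    errorTerm τ (interp τ c t) (interp τ c (t - τ)) (η t)

/-- `η ∈ C^∞([0, ∞), C^∞(I; ℝ²))`, as a function `η t s` of time and curve parameter: `η` is
jointly smooth on `[0, ∞) × I`, up to the boundary. -/
def IsTestFunction (η : ℝ → ℝ → Plane) : Prop :=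
  ContDiffOn ℝ ∞ (fun p : ℝ × ℝ => η p.1 p.2) (Ici 0 ×ˢ I)

end ElasticFlow

namespace ElasticFlow

/-! The identity holds at each time, because for small `τ` every step is an unconstrained critical
point. The energy is nonnegative along the scheme and bounds length (above and below) and bending,
and one step dissipates at most `τ` times the initial energy. With these bounds, small dissipation
forces the displacement `w = γ - γ'` to be uniformly small. The delicate direction is the tangential
one, which the dissipation does not see: at an interior maximum of `|w|²` the components of `w`
along `γ_s` and `γ'_s` agree, and the angle constraint excludes opposite signs. Hölder continuity of
the tangents then makes `γ_s - γ'_s` small, so the angle inequality is strict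
(`exists_dissipation_bound`, `exists_timeStep_bound`).

The class `AC` is varied intrinsically: translate the starting point by `δ a`, rotate the tangent by
`δ α(s)` and stretch it by `1 + δ lam`. The speed stays constant, so no Lagrange multiplier is
needed. Vanishing of the first variation (`stepVarDeriv_eq_zero`) splits into a balance for each of
`a`, `lam` and `α` (`weak_balance`). The one for `α` and the du Bois-Reymond lemma show that the
turning rate is `C¹` and zero at both ends (`turn_eq`, `turn_zero`, `turn_one`).

A test field `η` need not preserve constant speed; `X = η + P₁ γ_s` does to first order, since `X_s
= lam γ_s + α R γ_s` with `lam` constant. Here `α` contains `P₁` times the turning rate, so the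
regularity makes `X` an admissible direction (`strong_balance`). Integrations by parts identify the
variation in direction `X` with `E + D + Err` (`energyTerm_eq`, `dissipationTerm_add_errorTerm`). -/

/-! ### Rotation and orthogonal frames in the plane -/

theorem inner_coord (x y : Plane) : ⟪x, y⟫ = x 0 * y 0 + x 1 * y 1 := by
  simp [PiLp.inner_apply, Fin.sum_univ_two, mul_comm]

@[simp] theorem rot_apply_zero (a : Plane) : rot a 0 = -(a 1) := by simp [rot]

@[simp] theorem rot_apply_one (a : Plane) : rot a 1 = a 0 := by simp [rot]

/-- The rotation `rot` as a continuous linear map. -/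
noncomputable def rotL : Plane →L[ℝ] Plane :=
  LinearMap.toContinuousLinearMap
    { toFun := rot
      map_add' := fun x y => by ext i; fin_cases i <;> simp [rot]; ring
      map_smul' := fun c x => by ext i; fin_cases i <;> simp [rot] }

theorem rot_add (a b : Plane) : rot (a + b) = rot a + rot b := rotL.map_add a b

theorem rot_sub (a b : Plane) : rot (a - b) = rot a - rot b := rotL.map_sub a b

theorem rot_smul (c : ℝ) (a : Plane) : rot (c • a) = c • rot a := rotL.map_smul c a

theorem rot_rot (a : Plane) : rot (rot a) = -a := by
  ext i; fin_cases i <;> simp [rot]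

@[fun_prop] theorem continuous_rot : Continuous rot := rotL.continuous

theorem _root_.HasDerivAt.rot {f : ℝ → Plane} {f' : Plane} {x : ℝ} (h : HasDerivAt f f' x) :
    HasDerivAt (fun s => rot (f s)) (rot f') x :=
  rotL.hasFDerivAt.comp_hasDerivAt x h

theorem _root_.HasDerivWithinAt.rot {f : ℝ → Plane} {f' : Plane} {x : ℝ} {S : Set ℝ}
    (h : HasDerivWithinAt f f' S x) : HasDerivWithinAt (fun s => rot (f s)) (rot f') S x :=
  rotL.hasFDerivAt.comp_hasDerivWithinAt x h

theorem inner_rot_rot (a b : Plane) : ⟪rot a, rot b⟫ = ⟪a, b⟫ := by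
  simp only [inner_coord, rot_apply_zero, rot_apply_one]; ring

theorem inner_rot_left (a b : Plane) : ⟪rot a, b⟫ = -⟪a, rot b⟫ := by
  simp only [inner_coord, rot_apply_zero, rot_apply_one]; ring

@[simp] theorem inner_self_rot (a : Plane) : ⟪a, rot a⟫ = 0 := by
  simp only [inner_coord, rot_apply_zero, rot_apply_one]; ring

@[simp] theorem inner_rot_self (a : Plane) : ⟪rot a, a⟫ = 0 := by
  simp only [inner_coord, rot_apply_zero, rot_apply_one]; ring

@[simp] theorem norm_rot (a : Plane) : ‖rot a‖ = ‖a‖ := by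
  rw [← sq_eq_sq₀ (norm_nonneg _) (norm_nonneg _), ← real_inner_self_eq_norm_sq,
    ← real_inner_self_eq_norm_sq, inner_rot_rot]

/-- Expansion in the orthogonal frame `t`, `rot t`, multiplied out so that `t = 0` needs no
exception. -/
theorem norm_sq_smul_eq (t x : Plane) :
    ‖t‖ ^ 2 • x = ⟪x, t⟫ • t + ⟪x, rot t⟫ • rot t := by
  rw [← real_inner_self_eq_norm_sq, inner_coord t t]
  ext i; fin_cases i <;> simp [inner_coord] <;> ring

/-- Parseval in the frame `x`, `rot x`, after moving the rotation to the other factor. It turns the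
angle constraint into sign information on tangential components. -/
theorem inner_mul_add_inner_rot_mul (x a b : Plane) :
    ⟪x, a⟫ * ⟪x, b⟫ + ⟪x, rot a⟫ * ⟪x, rot b⟫ = ‖x‖ ^ 2 * ⟪a, b⟫ := by
  rw [← real_inner_self_eq_norm_sq]
  simp only [inner_coord, rot_apply_zero, rot_apply_one]; ring

theorem inner_sq_add_inner_rot_sq (x a : Plane) :
    ⟪x, a⟫ ^ 2 + ⟪x, rot a⟫ ^ 2 = ‖x‖ ^ 2 * ‖a‖ ^ 2 := by
  rw [← real_inner_self_eq_norm_sq a, ← inner_mul_add_inner_rot_mul]; ring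

/-! ### Calculus on the parameter interval -/

/-- The nearest point projection of the line onto `I`. -/
noncomputable def clamp (s : ℝ) : ℝ := max 0 (min 1 s)

@[fun_prop] theorem continuous_clamp : Continuous clamp := by unfold clamp; fun_prop

theorem clamp_mem (s : ℝ) : clamp s ∈ I := by simp [clamp]

theorem clamp_of_mem {s : ℝ} (hs : s ∈ I) : clamp s = s := by
  simp [clamp, hs.1, hs.2]

theorem continuous_comp_clamp {X : Type*} [TopologicalSpace X] {f : ℝ → X}
    (hf : ContinuousOn f I) : Continuous fun s => f (clamp s) :=
  hf.comp_continuous continuous_clamp clamp_mem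

theorem uIcc_eq_I : uIcc (0 : ℝ) 1 = I := uIcc_of_le zero_le_one

theorem uniqueDiffOn_I : UniqueDiffOn ℝ I := uniqueDiffOn_Icc zero_lt_one

theorem zero_mem_I : (0 : ℝ) ∈ I := by simp

theorem one_mem_I : (1 : ℝ) ∈ I := by simp

theorem uIcc_subset_I {x y : ℝ} (hx : x ∈ I) (hy : y ∈ I) : uIcc x y ⊆ I :=
  (convex_Icc (0 : ℝ) 1).ordConnected.uIcc_subset hx hy

theorem integral_congr_I {E : Type*} [NormedAddCommGroup E] [NormedSpace ℝ E] {f g : ℝ → E}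
    (h : EqOn f g I) : ∫ s in (0 : ℝ)..1, f s = ∫ s in (0 : ℝ)..1, g s :=
  intervalIntegral.integral_congr (by rwa [uIcc_eq_I])

theorem ds_eq_of_hasDerivWithinAt {f : ℝ → Plane} {f' : Plane} {s : ℝ} (hs : s ∈ I)
    (h : HasDerivWithinAt f f' I s) : ds f s = f' :=
  h.derivWithin (uniqueDiffOn_I s hs)

theorem ds_congr {f g : ℝ → Plane} (h : EqOn f g I) : EqOn (ds f) (ds g) I :=
  fun _ hs => derivWithin_congr h (h hs)

theorem MemH2.hasDerivWithinAt {γ : ℝ → Plane} (h : MemH2 γ) {s : ℝ} (hs : s ∈ I) :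
    HasDerivWithinAt γ (ds γ s) I s :=
  ((h.1.differentiableOn one_ne_zero) s hs).hasDerivWithinAt

theorem MemH2.continuousOn {γ : ℝ → Plane} (h : MemH2 γ) : ContinuousOn γ I := h.1.continuousOn

theorem MemH2.continuousOn_ds {γ : ℝ → Plane} (h : MemH2 γ) : ContinuousOn (ds γ) I :=
  h.1.continuousOn_derivWithin uniqueDiffOn_I le_rfl

/-- Fundamental theorem of calculus on subintervals of `I`. -/
theorem integral_eq_sub_of_hasDerivWithinAt_I {E : Type*} [NormedAddCommGroup E]
    [NormedSpace ℝ E] [CompleteSpace E] {f f' : ℝ → E}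
    (h : ∀ s ∈ I, HasDerivWithinAt f (f' s) I s) (hc : ContinuousOn f' I) {x y : ℝ}
    (hx : x ∈ I) (hy : y ∈ I) : ∫ s in x..y, f' s = f y - f x := by
  have hsub := uIcc_subset_I hx hy
  refine intervalIntegral.integral_eq_sub_of_hasDeriv_right
    (fun s hs => ((h s (hsub hs)).continuousWithinAt).mono hsub) ?_
    (hc.mono hsub).intervalIntegrable
  intro s hs
  have hs0 : (0 : ℝ) ≤ min x y := le_min hx.1 hy.1
  have hs1 : max x y ≤ (1 : ℝ) := max_le hx.2 hy.2
  refine ((h s ⟨by linarith [hs.1], by linarith [hs.2]⟩).hasDerivAt ?_).hasDerivWithinAt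
  exact Icc_mem_nhds (by linarith [hs.1]) (by linarith [hs.2])

theorem absolutelyContinuousOnInterval_lipschitz_comp {X Y : Type*} [PseudoMetricSpace X]
    [PseudoMetricSpace Y] {f : ℝ → X} {g : X → Y} {K : NNReal} {a b : ℝ}
    (hf : AbsolutelyContinuousOnInterval f a b) (hg : LipschitzWith K g) :
    AbsolutelyContinuousOnInterval (fun s => g (f s)) a b := by
  refine squeeze_zero (fun t => Finset.sum_nonneg fun i _ => dist_nonneg) (fun t => ?_)
    (by simpa using Filter.Tendsto.const_mul (K : ℝ) hf)
  rw [Finset.mul_sum]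
  exact Finset.sum_le_sum fun i _ => hg.dist_le_mul _ _

theorem absolutelyContinuousOnInterval_congr {X : Type*} [PseudoMetricSpace X]
    {f g : ℝ → X} {a b : ℝ} (hf : AbsolutelyContinuousOnInterval f a b)
    (h : EqOn f g (uIcc a b)) : AbsolutelyContinuousOnInterval g a b := by
  rw [absolutelyContinuousOnInterval_iff] at hf ⊢
  intro ε hε
  obtain ⟨δ, hδ, H⟩ := hf ε hε
  refine ⟨δ, hδ, fun E hE hs => ?_⟩
  convert! H E hE hs using 2 with i hi
  rw [h (hE.1 i hi).1, h (hE.1 i hi).2]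

theorem absolutelyContinuousOnInterval_coord {f : ℝ → Plane} {a b : ℝ}
    (hf : AbsolutelyContinuousOnInterval f a b) (i : Fin 2) :
    AbsolutelyContinuousOnInterval (fun s => f s i) a b :=
  absolutelyContinuousOnInterval_lipschitz_comp hf
    (g := fun x : Plane => x i) (EuclideanSpace.proj (𝕜 := ℝ) i).lipschitz

theorem ae_hasDerivAt_ds {f : ℝ → Plane} (hf : AbsolutelyContinuousOnInterval f 0 1) :
    ∀ᵐ s, s ∈ I → HasDerivAt f (ds f s) s := by
  have h := fun i => (absolutelyContinuousOnInterval_coord hf i).ae_differentiableAt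
  have h0 : ∀ᵐ s : ℝ, s ≠ 0 := by simp [ae_iff, measure_singleton]
  have h1 : ∀ᵐ s : ℝ, s ≠ 1 := by simp [ae_iff, measure_singleton]
  filter_upwards [h 0, h 1, h0, h1] with s a0 a1 n0 n1 hs
  rw [← uIcc_eq_I] at hs
  have hd : DifferentiableAt ℝ f s := by
    rw [differentiableAt_euclidean]
    intro i
    fin_cases i
    · exact a0 hs
    · exact a1 hs
  rw [uIcc_eq_I] at hs
  have hn : I ∈ nhds s := Icc_mem_nhds (lt_of_le_of_ne hs.1 n0.symm) (lt_of_le_of_ne hs.2 n1)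
  rw [ds, derivWithin_of_mem_nhds hn]
  exact hd.hasDerivAt

theorem intervalIntegrable_of_memLp_two {E : Type*} [NormedAddCommGroup E] {f : ℝ → E}
    (hf : MemLp f 2 (volume.restrict I)) {x y : ℝ} (hx : x ∈ I) (hy : y ∈ I) :
    IntervalIntegrable f volume x y := by
  have h1 : IntegrableOn f I := hf.integrable one_le_two
  exact (h1.mono_set (uIcc_subset_I hx hy)).intervalIntegrable

/-- Absolute continuity of the tangent is what makes this true; an a.e. derivative in `L²` would not
suffice. The argument is coordinatewise. -/
theorem MemH2.integral_ds_ds {γ : ℝ → Plane} (h : MemH2 γ) {x y : ℝ} (hx : x ∈ I) (hy : y ∈ I) :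
    ∫ s in x..y, ds (ds γ) s = ds γ y - ds γ x := by
  have hint := intervalIntegrable_of_memLp_two h.2.2 hx hy
  ext i
  have hac := (absolutelyContinuousOnInterval_coord h.2.1 i).mono
    (c := x) (d := y) (by rw [uIcc_eq_I]; exact uIcc_subset_I hx hy)
  have e1 : (∫ s in x..y, ds (ds γ) s) i = ∫ s in x..y, (ds (ds γ) s) i :=
    ((EuclideanSpace.proj (𝕜 := ℝ) i).intervalIntegral_comp_comm hint).symm
  rw [e1, PiLp.sub_apply, ← hac.integral_deriv_eq_sub]
  refine intervalIntegral.integral_congr_ae ?_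
  filter_upwards [ae_hasDerivAt_ds h.2.1] with s hs hxy
  have := hs (uIcc_subset_I hx hy (uIoc_subset_uIcc hxy))
  exact ((EuclideanSpace.proj (𝕜 := ℝ) i).hasFDerivAt.comp_hasDerivAt s this).deriv.symm

/-! ### Curves of constant speed and their turning rate -/

/-- The rate of rotation of the tangent: `γ_ss = turn γ • R γ_s` for admissible curves. -/
noncomputable def turn (γ : ℝ → Plane) (s : ℝ) : ℝ :=
  ⟪ds (ds γ) s, rot (ds γ s)⟫ / length γ ^ 2

theorem AC.memH2 {γ : ℝ → Plane} (h : γ ∈ AC) : MemH2 γ := h.1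

theorem AC.norm_ds {γ : ℝ → Plane} (h : γ ∈ AC) {s : ℝ} (hs : s ∈ I) :
    ‖ds γ s‖ = length γ := h.2.1 s hs

theorem AC.norm_sub_le_length {γ : ℝ → Plane} (h : γ ∈ AC) : ‖γ 1 - γ 0‖ ≤ length γ := by
  rw [← integral_eq_sub_of_hasDerivWithinAt_I (fun s hs => (AC.memH2 h).hasDerivWithinAt hs)
    (AC.memH2 h).continuousOn_ds zero_mem_I one_mem_I]
  exact intervalIntegral.norm_integral_le_integral_norm zero_le_one

theorem AC.norm_sub_pos {γ : ℝ → Plane} (h : γ ∈ AC) : 0 < ‖γ 1 - γ 0‖ :=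
  norm_pos_iff.2 (sub_ne_zero.2 h.2.2.symm)

theorem AC.length_pos {γ : ℝ → Plane} (h : γ ∈ AC) : 0 < length γ :=
  (AC.norm_sub_pos h).trans_le (AC.norm_sub_le_length h)

/-- Differentiate the constant `|γ_s|²`. At points where the tangent is not differentiable,
`derivWithin` is zero by convention, so no exceptional set appears. -/
theorem AC.inner_ds_ds {γ : ℝ → Plane} (h : γ ∈ AC) {s : ℝ} (hs : s ∈ I) :
    ⟪ds (ds γ) s, ds γ s⟫ = 0 := by
  by_cases hd : DifferentiableWithinAt ℝ (ds γ) I s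
  · have h1 := hd.hasDerivWithinAt.inner ℝ hd.hasDerivWithinAt
    have h2 : HasDerivWithinAt (fun t => ⟪ds γ t, ds γ t⟫) (0 : ℝ) I s :=
      (hasDerivWithinAt_const s I (length γ ^ 2)).congr
        (fun t ht => by rw [real_inner_self_eq_norm_sq, AC.norm_ds h ht])
        (by rw [real_inner_self_eq_norm_sq, AC.norm_ds h hs])
    have h3 := (uniqueDiffOn_I s hs).eq_deriv _ h1 h2
    have h4 : ds (ds γ) s = derivWithin (ds γ) I s := rfl
    rw [← h4, real_inner_comm] at h3
    linarith
  · have : ds (ds γ) s = 0 := derivWithin_zero_of_not_differentiableWithinAt hd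
    rw [this, inner_zero_left]

theorem AC.ds_ds_eq {γ : ℝ → Plane} (h : γ ∈ AC) {s : ℝ} (hs : s ∈ I) :
    ds (ds γ) s = turn γ s • rot (ds γ s) := by
  have hL := AC.length_pos h
  have h1 := norm_sq_smul_eq (ds γ s) (ds (ds γ) s)
  rw [AC.inner_ds_ds h hs, zero_smul, zero_add, AC.norm_ds h hs] at h1
  rw [turn, div_eq_inv_mul, mul_smul, ← h1, smul_smul, inv_mul_cancel₀ (by positivity), one_smul]

theorem AC.curvature_eq {γ : ℝ → Plane} (h : γ ∈ AC) {s : ℝ} (hs : s ∈ I) :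
    curvature γ s = turn γ s / length γ := by
  have hL := AC.length_pos h
  rw [curvature, turn, AC.norm_ds h hs]
  field_simp

theorem AC.norm_ds_ds {γ : ℝ → Plane} (h : γ ∈ AC) {s : ℝ} (hs : s ∈ I) :
    ‖ds (ds γ) s‖ = |turn γ s| * length γ := by
  rw [AC.ds_ds_eq h hs, norm_smul, norm_rot, AC.norm_ds h hs, Real.norm_eq_abs]

theorem AC.memLp_turn {γ : ℝ → Plane} (h : γ ∈ AC) : MemLp (turn γ) 2 (volume.restrict I) := by
  have hL := AC.length_pos h
  have h1 : AEStronglyMeasurable (fun s => rot (ds γ s)) (volume.restrict I) :=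
    (continuous_rot.comp_continuousOn (AC.memH2 h).continuousOn_ds).aestronglyMeasurable
      measurableSet_Icc
  refine ((AC.memH2 h).2.2.const_smul (length γ)⁻¹).mono ?_ ?_
  · have h2 := ((AC.memH2 h).2.2.aestronglyMeasurable.inner (𝕜 := ℝ) h1).const_mul
      (length γ ^ 2)⁻¹
    refine h2.congr (Filter.Eventually.of_forall fun s => ?_)
    simp only [turn, div_eq_inv_mul]
  · refine (ae_restrict_iff' measurableSet_Icc).2 (Filter.Eventually.of_forall fun s hs => ?_)
    simp only [Pi.smul_apply, norm_smul, AC.norm_ds_ds h hs, norm_inv, Real.norm_eq_abs,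
      abs_of_pos hL]
    rw [mul_comm, mul_assoc, mul_inv_cancel₀ hL.ne', mul_one]

theorem AC.intervalIntegrable_turn {γ : ℝ → Plane} (h : γ ∈ AC) {x y : ℝ} (hx : x ∈ I)
    (hy : y ∈ I) : IntervalIntegrable (turn γ) volume x y :=
  intervalIntegrable_of_memLp_two (AC.memLp_turn h) hx hy

theorem AC.intervalIntegrable_turn_sq {γ : ℝ → Plane} (h : γ ∈ AC) {x y : ℝ} (hx : x ∈ I)
    (hy : y ∈ I) : IntervalIntegrable (fun s => turn γ s ^ 2) volume x y :=
  (IntegrableOn.mono_set (AC.memLp_turn h).integrable_sq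
    (uIcc_subset_I hx hy)).intervalIntegrable

/-- Constant speed makes the bending energy quadratic in `turn γ`, the quantity on which rotations
of the tangent act additively. -/
theorem AC.energy_eq {γ : ℝ → Plane} (h : γ ∈ AC) (ε : ℝ) :
    energy ε γ = length γ + ε / 2 * ((∫ s in (0 : ℝ)..1, turn γ s ^ 2) / length γ) -
      Real.log ‖γ 1 - γ 0‖ := by
  have hL := AC.length_pos h
  rw [energy, ← intervalIntegral.integral_div]
  congr 3
  refine integral_congr_I fun s hs => ?_
  simp only [AC.curvature_eq h hs, AC.norm_ds h hs]
  field_simp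

theorem AC.ds_sub_ds {γ : ℝ → Plane} (h : γ ∈ AC) {x y : ℝ} (hx : x ∈ I) (hy : y ∈ I) :
    ds γ y - ds γ x = ∫ s in x..y, turn γ s • rot (ds γ s) := by
  rw [← (AC.memH2 h).integral_ds_ds hx hy]
  exact intervalIntegral.integral_congr fun s hs => AC.ds_ds_eq h (uIcc_subset_I hx hy hs)

/-- Hölder continuity of the tangent, with the bending energy controlling the constant. -/
theorem AC.norm_ds_sub_sq_le {γ : ℝ → Plane} (h : γ ∈ AC) {x y : ℝ} (hx : x ∈ I) (hy : y ∈ I) :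
    ‖ds γ y - ds γ x‖ ^ 2 ≤ length γ ^ 2 * (∫ s in (0 : ℝ)..1, turn γ s ^ 2) * |y - x| := by
  wlog hxy : x ≤ y generalizing x y
  · rw [norm_sub_rev, abs_sub_comm]
    exact this hy hx (le_of_not_ge hxy)
  have hL := AC.length_pos h
  have i1 := AC.intervalIntegrable_turn h hx hy
  have i2 := AC.intervalIntegrable_turn_sq h hx hy
  have hsub := uIcc_subset_I hx hy
  set A := ∫ s in x..y, turn γ s ^ 2 with hA
  set B := ∫ s in x..y, |turn γ s| with hB
  have h1 : ‖ds γ y - ds γ x‖ ≤ length γ * B := by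
    rw [AC.ds_sub_ds h hx hy, hB, ← intervalIntegral.integral_const_mul]
    refine (intervalIntegral.norm_integral_le_integral_norm hxy).trans (le_of_eq ?_)
    refine intervalIntegral.integral_congr fun s hs => ?_
    simp only [norm_smul, norm_rot, AC.norm_ds h (hsub hs), Real.norm_eq_abs, mul_comm]
  have hB0 : 0 ≤ B := intervalIntegral.integral_nonneg hxy fun s _ => abs_nonneg _
  have h2 : B ^ 2 ≤ (y - x) * A := by
    -- Cauchy-Schwarz: the integral of `(|turn γ| - r) ^ 2` is nonnegative for all `r`, and the
    -- optimal `r` is the mean `B / (y - x)`.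
    have key : ∀ r : ℝ, 0 ≤ A - 2 * r * B + r ^ 2 * (y - x) := by
      intro r
      have : ∫ s in x..y, (|turn γ s| - r) ^ 2 = A - 2 * r * B + r ^ 2 * (y - x) := by
        have e : ∀ s, (|turn γ s| - r) ^ 2 = turn γ s ^ 2 - 2 * r * |turn γ s| + r ^ 2 :=
          fun s => by rw [sub_sq, sq_abs]; ring
        simp_rw [e]
        rw [intervalIntegral.integral_add (i2.sub (i1.abs.const_mul _))
          intervalIntegrable_const, intervalIntegral.integral_sub i2 (i1.abs.const_mul _),
          intervalIntegral.integral_const_mul, intervalIntegral.integral_const, smul_eq_mul]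
        ring
      rw [← this]
      exact intervalIntegral.integral_nonneg hxy fun s _ => sq_nonneg _
    rcases hxy.eq_or_lt with rfl | hlt
    · simp [hB]
    · have hd : 0 < y - x := sub_pos.2 hlt
      have := key (B / (y - x))
      have e : A - 2 * (B / (y - x)) * B + (B / (y - x)) ^ 2 * (y - x) =
          ((y - x) * A - B ^ 2) / (y - x) := by field_simp; ring
      rw [e] at this
      have := (div_nonneg_iff.1 this).resolve_right (fun h => by linarith [h.2])
      linarith [this.1]
  have h3 : A ≤ ∫ s in (0 : ℝ)..1, turn γ s ^ 2 :=
    intervalIntegral.integral_mono_interval hx.1 hxy hy.2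
      (Filter.Eventually.of_forall fun s => sq_nonneg _)
      (AC.intervalIntegrable_turn_sq h zero_mem_I one_mem_I)
  rw [abs_of_nonneg (sub_nonneg.2 hxy)]
  calc ‖ds γ y - ds γ x‖ ^ 2 ≤ (length γ * B) ^ 2 := by gcongr
    _ = length γ ^ 2 * B ^ 2 := by ring
    _ ≤ length γ ^ 2 * ((y - x) * A) := by gcongr
    _ ≤ length γ ^ 2 * ((y - x) * ∫ s in (0 : ℝ)..1, turn γ s ^ 2) := by
        have := sub_nonneg.2 hxy
        gcongr
    _ = _ := by ring

/-! ### Small dissipation keeps the angle constraint inactive -/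

theorem exists_mem_I_abs_sub_eq {h : ℝ} (h0 : 0 ≤ h) (h1 : h ≤ 1 / 2) {s : ℝ} (hs : s ∈ I) :
    ∃ y ∈ I, |y - s| = h := by
  rcases le_total s (1 / 2) with hc | hc
  · exact ⟨s + h, ⟨by linarith [hs.1], by linarith⟩, by simpa using h0⟩
  · refine ⟨s - h, ⟨by linarith, by linarith [hs.2]⟩, by simpa using h0⟩

/-- A continuous function with a given modulus of continuity is uniformly small if it is small in
mean square. -/
theorem abs_le_of_integral_sq_lt {f : ℝ → ℝ} {h e : ℝ} (hf : ContinuousOn f I) (h0 : 0 < h)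
    (h1 : h ≤ 1 / 2) (he : 0 < e)
    (hmod : ∀ x ∈ I, ∀ y ∈ I, |y - x| ≤ h → |f y - f x| ≤ e / 2)
    (hint : ∫ s in (0 : ℝ)..1, f s ^ 2 < h * (e / 2) ^ 2) {s : ℝ} (hs : s ∈ I) : |f s| ≤ e := by
  by_contra! hcon
  -- Between `s` and a point `y` at distance `h`, the modulus keeps `|f| ≥ e / 2`, so this interval
  -- alone contributes `h * (e / 2) ^ 2` to the integral.
  obtain ⟨y, hy, hys⟩ := exists_mem_I_abs_sub_eq h0.le h1 hs
  have hcont : ContinuousOn (fun s => f s ^ 2) I := hf.pow 2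
  have hmin : min s y ∈ I := ⟨le_min hs.1 hy.1, (min_le_left _ _).trans hs.2⟩
  have hmax : max s y ∈ I := ⟨hs.1.trans (le_max_left _ _), max_le hs.2 hy.2⟩
  have hle : min s y ≤ max s y := min_le_max
  have hlen : max s y - min s y = h := by rw [max_sub_min_eq_abs, hys]
  have i1 : IntervalIntegrable (fun s => f s ^ 2) volume (min s y) (max s y) :=
    (hcont.mono (uIcc_subset_I hmin hmax)).intervalIntegrable
  have a1 : ∫ r in min s y..max s y, f r ^ 2 ≤ ∫ r in (0 : ℝ)..1, f r ^ 2 :=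
    intervalIntegral.integral_mono_interval hmin.1 hle hmax.2
      (Filter.Eventually.of_forall fun s => sq_nonneg _)
      (hcont.mono (uIcc_subset_I zero_mem_I one_mem_I)).intervalIntegrable
  have a2 : ∫ r in min s y..max s y, (e / 2) ^ 2 ≤ ∫ r in min s y..max s y, f r ^ 2 := by
    refine intervalIntegral.integral_mono_on hle intervalIntegrable_const i1 fun r hr => ?_
    have hrI : r ∈ I := ⟨hmin.1.trans hr.1, hr.2.trans hmax.2⟩
    have hrs : |r - s| ≤ h := by
      rw [← hlen, abs_le]
      constructor <;> linarith [hr.1, hr.2, min_le_left s y, le_max_left s y]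
    have := hmod s hs r hrI hrs
    have h2 : e / 2 ≤ |f r| := by
      have := abs_sub_abs_le_abs_sub (f s) (f r)
      rw [abs_sub_comm] at this
      linarith
    rw [← sq_abs (f r)]
    gcongr
  rw [intervalIntegral.integral_const, hlen, smul_eq_mul] at a2
  linarith

/-- If `|x - y| ≤ |x + y|`, then `(x - y)²` is at most `|x - y| |x + y|`. Otherwise `(x + y)²` is,
and `(x - y)² = (x + y)² - 4xy`. -/
theorem sq_sub_le_of_neg_le_mul {x y σ : ℝ} (h : -σ ^ 2 ≤ x * y) :
    (x - y) ^ 2 ≤ |x ^ 2 - y ^ 2| + 4 * σ ^ 2 := by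
  have e : |x ^ 2 - y ^ 2| = |x - y| * |x + y| := by rw [← abs_mul]; congr 1; ring
  rw [e]
  rcases le_total |x - y| |x + y| with hc | hc
  · have := mul_le_mul_of_nonneg_left hc (abs_nonneg (x - y))
    rw [← sq, sq_abs] at this
    nlinarith [sq_nonneg σ]
  · have := mul_le_mul_of_nonneg_right hc (abs_nonneg (x + y))
    rw [← sq, sq_abs] at this
    nlinarith

/-- Two curves of constant speed whose tangents enclose an angle of at most `π / 2` are close if
their end points are close and each is close to the other in normal direction. -/
theorem AC.norm_sub_sq_le {γ γ' : ℝ → Plane} (h : γ ∈ ACAngle γ') (h' : γ' ∈ AC) {σ : ℝ}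
    (hσ : 0 ≤ σ) (hf : ∀ s ∈ I, |⟪γ s - γ' s, rot (ds γ' s)⟫| ≤ σ)
    (hg : ∀ s ∈ I, |⟪γ s - γ' s, rot (ds γ s)⟫| ≤ σ)
    (h0 : ‖γ 0 - γ' 0‖ ≤ σ) (h1 : ‖γ 1 - γ' 1‖ ≤ σ) {s : ℝ} (hs : s ∈ I) :
    ‖γ s - γ' s‖ ^ 2 ≤ σ ^ 2 + 6 * σ := by
  have hγ := AC.memH2 h.1
  have hγ' := AC.memH2 h'
  set w : ℝ → Plane := fun s => γ s - γ' s with hw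
  have hderiv : ∀ s ∈ I, HasDerivWithinAt (fun s => ‖w s‖ ^ 2)
      (2 * (⟪w s, ds γ s⟫ - ⟪w s, ds γ' s⟫)) I s := by
    intro s hs
    have := ((hγ.hasDerivWithinAt hs).sub (hγ'.hasDerivWithinAt hs)).norm_sq
    rw [inner_sub_right] at this
    exact this
  have hcont : ContinuousOn (fun s => ‖w s‖ ^ 2) I := fun s hs => (hderiv s hs).continuousWithinAt
  obtain ⟨p, hp, hpmax⟩ := isCompact_Icc.exists_isMaxOn ⟨0, zero_mem_I⟩ hcont
  by_cases hsmall : ‖w p‖ ^ 2 ≤ σ ^ 2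
  · have : ‖w s‖ ^ 2 ≤ ‖w p‖ ^ 2 := hpmax hs
    linarith
  have hp0 : p ≠ 0 := by
    rintro rfl
    exact hsmall (pow_le_pow_left₀ (norm_nonneg _) h0 2)
  have hp1 : p ≠ 1 := by
    rintro rfl
    exact hsmall (pow_le_pow_left₀ (norm_nonneg _) h1 2)
  have hn : I ∈ nhds p := Icc_mem_nhds (lt_of_le_of_ne hp.1 hp0.symm) (lt_of_le_of_ne hp.2 hp1)
  -- Criticality equates the two tangential components of `w p`. The difference of the two
  -- Pythagorean identities then contains only normal components, which bounds the mismatch of the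
  -- squared lengths, weighted by `‖w p‖ ^ 2`. As `p` is a maximum, the same bound holds at every
  -- `s`.
  have hcrit := (hpmax.isLocalMax hn).hasDerivAt_eq_zero ((hderiv p hp).hasDerivAt hn)
  have idγ : ∀ s ∈ I, ⟪w s, ds γ s⟫ ^ 2 + ⟪w s, rot (ds γ s)⟫ ^ 2 = ‖w s‖ ^ 2 * length γ ^ 2 :=
    fun s hs => by rw [inner_sq_add_inner_rot_sq, AC.norm_ds h.1 hs]
  have idγ' : ∀ s ∈ I, ⟪w s, ds γ' s⟫ ^ 2 + ⟪w s, rot (ds γ' s)⟫ ^ 2 =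
      ‖w s‖ ^ 2 * length γ' ^ 2 :=
    fun s hs => by rw [inner_sq_add_inner_rot_sq, AC.norm_ds h' hs]
  have hfsq : ∀ s ∈ I, ⟪w s, rot (ds γ' s)⟫ ^ 2 ≤ σ ^ 2 := fun s hs => sq_le_sq.2 (by
    rw [abs_of_nonneg hσ]; exact hf s hs)
  have hgsq : ∀ s ∈ I, ⟪w s, rot (ds γ s)⟫ ^ 2 ≤ σ ^ 2 := fun s hs => sq_le_sq.2 (by
    rw [abs_of_nonneg hσ]; exact hg s hs)
  have hlen : ‖w p‖ ^ 2 * |length γ ^ 2 - length γ' ^ 2| ≤ σ ^ 2 := by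
    rw [← abs_of_nonneg (sq_nonneg ‖w p‖), ← abs_mul, mul_sub, ← idγ p hp, ← idγ' p hp, abs_le]
    have : ⟪w p, ds γ p⟫ = ⟪w p, ds γ' p⟫ := by linarith
    rw [this]
    constructor <;>
      linarith [hfsq p hp, hgsq p hp, sq_nonneg (⟪w p, rot (ds γ' p)⟫),
        sq_nonneg (⟪w p, rot (ds γ p)⟫)]
  have hdiff : ∀ s ∈ I, |⟪w s, ds γ s⟫ - ⟪w s, ds γ' s⟫| ≤ 3 * σ := by
    intro s hs
    have hwle : ‖w s‖ ^ 2 ≤ ‖w p‖ ^ 2 := hpmax hs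
    have b1 : ‖w s‖ ^ 2 * |length γ ^ 2 - length γ' ^ 2| ≤ σ ^ 2 :=
      (mul_le_mul_of_nonneg_right hwle (abs_nonneg _)).trans hlen
    rw [← abs_of_nonneg (sq_nonneg ‖w s‖), ← abs_mul, abs_le] at b1
    have b2 : |⟪w s, ds γ s⟫ ^ 2 - ⟪w s, ds γ' s⟫ ^ 2| ≤ 2 * σ ^ 2 := by
      rw [abs_le]
      constructor <;>
        linarith [idγ s hs, idγ' s hs, hfsq s hs, hgsq s hs,
          sq_nonneg (⟪w s, rot (ds γ' s)⟫), sq_nonneg (⟪w s, rot (ds γ s)⟫)]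
    -- The angle constraint enters here: without it the tangential components could be nearly equal
    -- in size but opposite in sign.
    have b3 : -σ ^ 2 ≤ ⟪w s, ds γ s⟫ * ⟪w s, ds γ' s⟫ := by
      have e := inner_mul_add_inner_rot_mul (w s) (ds γ s) (ds γ' s)
      have p1 : 0 ≤ ‖w s‖ ^ 2 * ⟪ds γ s, ds γ' s⟫ := mul_nonneg (sq_nonneg _) (h.2 s hs)
      have p2 : ⟪w s, rot (ds γ s)⟫ * ⟪w s, rot (ds γ' s)⟫ ≤ σ ^ 2 := by
        refine (le_abs_self _).trans ?_
        rw [abs_mul, sq]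
        exact mul_le_mul (hg s hs) (hf s hs) (abs_nonneg _) hσ
      linarith
    have b4 := sq_sub_le_of_neg_le_mul b3
    refine abs_le_of_sq_le_sq ?_ (by positivity)
    nlinarith [sq_nonneg σ]
  have hmv := Convex.norm_image_sub_le_of_norm_hasDerivWithin_le (C := 6 * σ) hderiv
    (fun s hs => by
      rw [Real.norm_eq_abs, abs_mul, abs_two]
      linarith [hdiff s hs]) (convex_Icc 0 1) zero_mem_I hs
  rw [Real.norm_eq_abs, Real.norm_eq_abs, sub_zero, abs_of_nonneg hs.1] at hmv
  have a1 := (abs_le.1 hmv).2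
  have a2 : ‖w 0‖ ^ 2 ≤ σ ^ 2 := pow_le_pow_left₀ (norm_nonneg _) h0 2
  have a3 : 6 * σ * s ≤ 6 * σ := mul_le_of_le_one_right (by positivity) hs.2
  simp only [hw] at a1 a2 ⊢
  linarith

/-- A uniformly small function whose derivative has a given modulus of continuity has a small
derivative. -/
theorem norm_deriv_lt_of_norm_le {w w' : ℝ → Plane} {h m η : ℝ}
    (hw : ∀ s ∈ I, HasDerivWithinAt w (w' s) I s) (h0 : 0 < h)
    (h1 : h ≤ 1 / 2) (hmod : ∀ x ∈ I, ∀ y ∈ I, |y - x| ≤ h → ‖w' y - w' x‖ ≤ m / 2)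
    (hη : η < h * m / 4) (hsup : ∀ s ∈ I, ‖w s‖ ≤ η) {s : ℝ} (hs : s ∈ I) : ‖w' s‖ < m := by
  obtain ⟨y, hy, hys⟩ := exists_mem_I_abs_sub_eq h0.le h1 hs
  have hsub := uIcc_subset_I hs hy
  -- Compare `w` with its linearization at `s` over the distance `h`: `h * ‖w' s‖` is at most `2 *
  -- η` plus the error `h * m / 2`, hence less than `h * m`.
  have hd : ∀ x ∈ uIcc s y, HasDerivWithinAt (fun x => w x - x • w' s) (w' x - w' s)
      (uIcc s y) x := by
    intro x hx
    have := (hasDerivWithinAt_id x (uIcc s y)).smul_const (w' s)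
    rw [one_smul] at this
    exact ((hw x (hsub hx)).mono hsub).sub this
  have hmv := Convex.norm_image_sub_le_of_norm_hasDerivWithin_le (C := m / 2) hd
    (fun x hx => hmod s hs x (hsub hx) (by
      rw [← hys]
      exact (abs_sub_left_of_mem_uIcc hx))) (convex_uIcc s y) left_mem_uIcc right_mem_uIcc
  rw [Real.norm_eq_abs, hys] at hmv
  have e : (y - s) • w' s = w y - w s - (w y - y • w' s - (w s - s • w' s)) := by module
  have hn : h * ‖w' s‖ ≤ η + η + m / 2 * h := by
    rw [← hys, ← Real.norm_eq_abs, ← norm_smul, e]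
    refine (norm_sub_le _ _).trans (add_le_add ((norm_sub_le _ _).trans
      (add_le_add (hsup y hy) (hsup s hs))) ?_)
    rw [Real.norm_eq_abs, hys]
    exact hmv
  by_contra! hcon
  have := mul_le_mul_of_nonneg_left hcon h0.le
  linarith

theorem abs_inner_rot_sub_le (a a' u u' : Plane) :
    |⟪a', rot u'⟫ - ⟪a, rot u⟫| ≤ ‖a' - a‖ * ‖u'‖ + ‖a‖ * ‖u' - u‖ := by
  have e : ⟪a', rot u'⟫ - ⟪a, rot u⟫ = ⟪a' - a, rot u'⟫ + ⟪a, rot (u' - u)⟫ := by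
    rw [rot_sub, inner_sub_left, inner_sub_right]; ring
  have d1 := abs_real_inner_le_norm (a' - a) (rot u')
  have d2 := abs_real_inner_le_norm a (rot (u' - u))
  rw [norm_rot] at d1 d2
  rw [e]
  exact (abs_add_le _ _).trans (add_le_add d1 d2)

set_option maxHeartbeats 1000000 in
/-- If the dissipation of a step between two curves with bounded length and bending energy is small
enough, then the angle constraint is not active. -/
theorem exists_dissipation_bound {m M K : ℝ} (hm : 0 < m) (hM : 0 < M) (hK : 0 ≤ K) :
    ∃ ρ : ℝ, 0 < ρ ∧ ∀ γ γ' : ℝ → Plane, γ ∈ ACAngle γ' → γ' ∈ AC →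
      m ≤ length γ → m ≤ length γ' → length γ ≤ M → length γ' ≤ M →
      ∫ s in (0 : ℝ)..1, turn γ s ^ 2 ≤ K → ∫ s in (0 : ℝ)..1, turn γ' s ^ 2 ≤ K →
      dissipation γ γ' ≤ ρ → ∀ s ∈ I, 0 < ⟪ds γ s, ds γ' s⟫ := by
  -- A scale `h` on which the Hölder bound lets the tangent oscillate by at most `e`; `h ≤ e` serves
  -- the Lipschitz bound for `w`, and `h ≤ 1 / 2` leaves room inside `I`.
  have hchoose : ∀ e : ℝ, 0 < e → ∃ h : ℝ, 0 < h ∧ h ≤ 1 / 2 ∧ h ≤ e ∧ M ^ 2 * K * h ≤ e ^ 2 := by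
    intro e he
    have hd : 0 < M ^ 2 * K + 1 := by positivity
    refine ⟨min (1 / 2) (min e (e ^ 2 / (M ^ 2 * K + 1))), by positivity, min_le_left _ _,
      (min_le_right _ _).trans (min_le_left _ _), ?_⟩
    calc M ^ 2 * K * min (1 / 2) (min e (e ^ 2 / (M ^ 2 * K + 1)))
        ≤ (M ^ 2 * K + 1) * (e ^ 2 / (M ^ 2 * K + 1)) := by
          refine mul_le_mul (by linarith) ((min_le_right _ _).trans (min_le_right _ _))
            (by positivity) hd.le
      _ = e ^ 2 := by field_simp
  have hhol : ∀ γ ∈ AC, length γ ≤ M → ∫ s in (0 : ℝ)..1, turn γ s ^ 2 ≤ K →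
      ∀ h e : ℝ, 0 ≤ e → M ^ 2 * K * h ≤ e ^ 2 →
      ∀ x ∈ I, ∀ y ∈ I, |y - x| ≤ h → ‖ds γ y - ds γ x‖ ≤ e := by
    intro γ hγ hL hk h e he hh x hx y hy hxy
    refine le_of_sq_le_sq ?_ he
    refine (AC.norm_ds_sub_sq_le hγ hx hy).trans (le_trans ?_ hh)
    have := AC.length_pos hγ
    have hk0 : 0 ≤ ∫ s in (0 : ℝ)..1, turn γ s ^ 2 :=
      intervalIntegral.integral_nonneg zero_le_one fun s _ => sq_nonneg _
    gcongr
  -- Each tangent oscillates by at most `m / 4`, their difference by `m / 2`; `η` is half the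
  -- threshold of `norm_deriv_lt_of_norm_le`.
  obtain ⟨h₁, h₁0, h₁1, -, h₁K⟩ := hchoose (m / 4) (by positivity)
  set η := h₁ * m / 8 with hη
  have hη0 : 0 < η := by positivity
  -- As `σ ≤ 1`, the bound `σ ^ 2 + 6 * σ` of `AC.norm_sub_sq_le` is at most `7 * σ ≤ η ^ 2`.
  set σ := min 1 (η ^ 2 / 7) with hσ
  have hσ0 : 0 < σ := by positivity
  have hσ1 : σ ≤ 1 := min_le_left _ _
  have hση : σ ^ 2 + 6 * σ ≤ η ^ 2 := by
    have e1 : σ ≤ η ^ 2 / 7 := min_le_right _ _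
    have e2 : σ ^ 2 ≤ σ := by rw [sq]; exact mul_le_of_le_one_left hσ0.le hσ1
    linarith only [e1, e2]
  -- Bound for `‖w‖`: at most `σ ≤ 1` at the starting point, with Lipschitz constant `2 * M`.
  set W := 1 + 2 * M with hW
  have hW0 : 0 < W := by positivity
  -- On the scale `h₂` the normal components of `w` vary by at most `σ / 2`: a share `σ / 4` from
  -- the change of `w` and another from that of the tangent.
  obtain ⟨h₂, h₂0, h₂1, h₂e, h₂K⟩ := hchoose (σ / (8 * W * (W + M))) (by positivity)
  have hMW : M ≤ W := by linarith
  -- The first entry pushes both normal integrals below `h₂ * (σ / 2) ^ 2`; the second bounds the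
  -- displacements of the end points by `σ`.
  refine ⟨min (h₂ * σ ^ 2 / (32 * M)) (σ ^ 2 / 2), by positivity, ?_⟩
  intro γ γ' h h' hm1 hm2 hM1 hM2 hK1 hK2 hD
  have hL := AC.length_pos h.1
  have hL' := AC.length_pos h'
  have hγ := AC.memH2 h.1
  have hγ' := AC.memH2 h'
  set w : ℝ → Plane := fun s => γ s - γ' s with hw
  have nn1 : 0 ≤ ∫ s in (0 : ℝ)..1, ⟪w s, rot (ds γ' s)⟫ ^ 2 :=
    intervalIntegral.integral_nonneg zero_le_one fun s _ => sq_nonneg _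
  have nn2 : 0 ≤ ∫ s in (0 : ℝ)..1, ⟪w s, rot (ds γ s)⟫ ^ 2 :=
    intervalIntegral.integral_nonneg zero_le_one fun s _ => sq_nonneg _
  have hDρ : 1 / (4 * length γ') * (∫ s in (0 : ℝ)..1, ⟪w s, rot (ds γ' s)⟫ ^ 2) +
      1 / (4 * length γ) * (∫ s in (0 : ℝ)..1, ⟪w s, rot (ds γ s)⟫ ^ 2) +
      1 / 2 * ‖w 0‖ ^ 2 + 1 / 2 * ‖w 1‖ ^ 2 ≤ min (h₂ * σ ^ 2 / (32 * M)) (σ ^ 2 / 2) := hD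
  have t1 : 0 ≤ 1 / (4 * length γ') * (∫ s in (0 : ℝ)..1, ⟪w s, rot (ds γ' s)⟫ ^ 2) := by
    positivity
  have t2 : 0 ≤ 1 / (4 * length γ) * (∫ s in (0 : ℝ)..1, ⟪w s, rot (ds γ s)⟫ ^ 2) := by
    positivity
  have t3 := sq_nonneg ‖w 0‖
  have t4 := sq_nonneg ‖w 1‖
  have hρ1 := hDρ.trans (min_le_left _ _)
  have hρ2 := hDρ.trans (min_le_right _ _)
  have hw0 : ‖w 0‖ ≤ σ := le_of_sq_le_sq (by linarith) hσ0.le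
  have hw1 : ‖w 1‖ ≤ σ := le_of_sq_le_sq (by linarith) hσ0.le
  have hsmall : ∀ L J : ℝ, 0 < L → L ≤ M → 0 ≤ J → 1 / (4 * L) * J ≤ h₂ * σ ^ 2 / (32 * M) →
      J < h₂ * (σ / 2) ^ 2 := by
    intro L J hL hLM hJ hle
    have hle' : 1 / (4 * M) * J ≤ h₂ * σ ^ 2 / (32 * M) := by
      refine le_trans ?_ hle
      gcongr
    have e1 : 1 / (4 * M) * J = J / 4 / M := by field_simp
    have e2 : h₂ * σ ^ 2 / (32 * M) = h₂ * σ ^ 2 / 32 / M := by field_simp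
    rw [e1, e2, div_le_div_iff_of_pos_right hM] at hle'
    have e3 : 0 < h₂ * σ ^ 2 := by positivity
    have e4 : h₂ * (σ / 2) ^ 2 = h₂ * σ ^ 2 / 4 := by ring
    linarith only [e3, e4, hle']
  have hwderiv : ∀ s ∈ I, HasDerivWithinAt w (ds γ s - ds γ' s) I s := fun s hs =>
    (hγ.hasDerivWithinAt hs).sub (hγ'.hasDerivWithinAt hs)
  have hwlip : ∀ x ∈ I, ∀ y ∈ I, ‖w y - w x‖ ≤ 2 * M * |y - x| := by
    intro x hx y hy
    refine Convex.norm_image_sub_le_of_norm_hasDerivWithin_le hwderiv (fun s hs => ?_)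
      (convex_Icc 0 1) hx hy
    refine (norm_sub_le _ _).trans ?_
    rw [AC.norm_ds h.1 hs, AC.norm_ds h' hs]
    linarith
  have hwbd : ∀ s ∈ I, ‖w s‖ ≤ W := by
    intro s hs
    have a1 := hwlip 0 zero_mem_I s hs
    rw [sub_zero, abs_of_nonneg hs.1] at a1
    have a2 : 2 * M * s ≤ 2 * M := mul_le_of_le_one_right (by positivity) hs.2
    have a3 : ‖w s‖ ≤ ‖w s - w 0‖ + ‖w 0‖ := by
      simpa using norm_add_le (w s - w 0) (w 0)
    linarith
  have hmod : ∀ ζ ∈ AC, length ζ ≤ M → ∫ s in (0 : ℝ)..1, turn ζ s ^ 2 ≤ K →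
      ∀ x ∈ I, ∀ y ∈ I, |y - x| ≤ h₂ →
      |⟪w y, rot (ds ζ y)⟫ - ⟪w x, rot (ds ζ x)⟫| ≤ σ / 2 := by
    intro ζ hζ hζM hζK x hx y hy hxy
    have b1 := hhol ζ hζ hζM hζK h₂ _ (by positivity) h₂K x hx y hy hxy
    have b2 := hwlip x hx y hy
    have c1 : ‖w y - w x‖ * ‖ds ζ y‖ ≤ 2 * M * (σ / (8 * W * (W + M))) * M := by
      rw [AC.norm_ds hζ hy]
      have : |y - x| ≤ σ / (8 * W * (W + M)) := hxy.trans h₂e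
      have : ‖w y - w x‖ ≤ 2 * M * (σ / (8 * W * (W + M))) := b2.trans (by gcongr)
      have := AC.length_pos hζ
      gcongr
    have c2 : ‖w x‖ * ‖ds ζ y - ds ζ x‖ ≤ W * (σ / (8 * W * (W + M))) := by
      have := hwbd x hx
      gcongr
    have c3 : 2 * M * (σ / (8 * W * (W + M))) * M ≤ σ / 4 := by
      have : 2 * M * (σ / (8 * W * (W + M))) * M = σ / 4 * ((M * M) / (W * (W + M))) := by
        field_simp; ring
      rw [this]
      refine mul_le_of_le_one_right (by positivity) ((div_le_one (by positivity)).2 ?_)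
      exact mul_le_mul hMW (by linarith) hM.le hW0.le
    have c4 : W * (σ / (8 * W * (W + M))) ≤ σ / 4 := by
      have : W * (σ / (8 * W * (W + M))) = σ / 8 * (1 / (W + M)) := by field_simp
      rw [this]
      have e1 : 1 / (W + M) ≤ 1 := (div_le_one (by positivity)).2 (by linarith only [hW, hM])
      have e2 := mul_le_mul_of_nonneg_left e1 (by positivity : 0 ≤ σ / 8)
      linarith only [e2, hσ0]
    exact (abs_inner_rot_sub_le _ _ _ _).trans (by linarith only [c1, c2, c3, c4])
  have hwc : ContinuousOn w I := hγ.continuousOn.sub hγ'.continuousOn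
  have hf : ∀ s ∈ I, |⟪w s, rot (ds γ' s)⟫| ≤ σ := fun s hs =>
    abs_le_of_integral_sq_lt (f := fun s => ⟪w s, rot (ds γ' s)⟫)
      (hwc.inner (𝕜 := ℝ) (continuous_rot.comp_continuousOn hγ'.continuousOn_ds)) h₂0 h₂1 hσ0
      (hmod γ' h' hM2 hK2) (hsmall _ _ hL' hM2 nn1 (by linarith)) hs
  have hg : ∀ s ∈ I, |⟪w s, rot (ds γ s)⟫| ≤ σ := fun s hs =>
    abs_le_of_integral_sq_lt (f := fun s => ⟪w s, rot (ds γ s)⟫)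
      (hwc.inner (𝕜 := ℝ) (continuous_rot.comp_continuousOn hγ.continuousOn_ds)) h₂0 h₂1 hσ0
      (hmod γ h.1 hM1 hK1) (hsmall _ _ hL hM1 nn2 (by linarith)) hs
  intro s hs
  have hlt : ‖ds γ s - ds γ' s‖ < m := by
    refine norm_deriv_lt_of_norm_le hwderiv h₁0 h₁1 (fun x hx y hy hxy => ?_)
      (η := η) (by rw [hη]; linarith only [mul_pos h₁0 hm]) (fun s hs => ?_) hs
    · have e : ds γ y - ds γ' y - (ds γ x - ds γ' x) =
          (ds γ y - ds γ x) - (ds γ' y - ds γ' x) := by abel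
      rw [e]
      have := hhol γ h.1 hM1 hK1 h₁ _ (by positivity) h₁K x hx y hy hxy
      have := hhol γ' h' hM2 hK2 h₁ _ (by positivity) h₁K x hx y hy hxy
      exact (norm_sub_le _ _).trans (by linarith)
    · exact le_of_sq_le_sq ((AC.norm_sub_sq_le h h' hσ0.le hf hg hw0 hw1 hs).trans hση) hη0.le
  -- Polarization: the tangents differ by less than `m`, while both have norm at least `m`.
  have e := norm_sub_sq_real (ds γ s) (ds γ' s)
  rw [AC.norm_ds h.1 hs, AC.norm_ds h' hs] at e
  have e1 : ‖ds γ s - ds γ' s‖ ^ 2 < m ^ 2 := by gcongr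
  have e2 : m ^ 2 ≤ length γ ^ 2 := by gcongr
  have e3 : m ^ 2 ≤ length γ' ^ 2 := by gcongr
  linarith only [e, e1, e2, e3, sq_pos_of_pos hm]

/-! ### A priori bounds from the energy, and the size of the time step -/

theorem AC.length_sub_log_le_energy {γ : ℝ → Plane} (h : γ ∈ AC) {ε : ℝ} (hε : 0 < ε) :
    length γ - Real.log ‖γ 1 - γ 0‖ ≤ energy ε γ := by
  have hL := AC.length_pos h
  have : 0 ≤ ∫ s in (0 : ℝ)..1, turn γ s ^ 2 :=
    intervalIntegral.integral_nonneg zero_le_one fun s _ => sq_nonneg _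
  have : 0 ≤ ε / 2 * ((∫ s in (0 : ℝ)..1, turn γ s ^ 2) / length γ) := by positivity
  rw [AC.energy_eq h]
  linarith

/-- The chord is no longer than the curve, and `log (L / 2) ≤ L / 2 - 1` with `log 2 < 1`. Half of
the length therefore survives the logarithm in the energy. -/
theorem AC.log_norm_sub_le {γ : ℝ → Plane} (h : γ ∈ AC) :
    Real.log ‖γ 1 - γ 0‖ ≤ length γ / 2 := by
  have hL := AC.length_pos h
  have h1 := Real.log_le_log (AC.norm_sub_pos h) (AC.norm_sub_le_length h)
  have h2 := Real.log_le_sub_one_of_pos (half_pos hL)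
  rw [Real.log_div hL.ne' two_ne_zero] at h2
  have h3 := Real.log_two_lt_d9
  linarith

theorem AC.energy_nonneg {γ : ℝ → Plane} (h : γ ∈ AC) {ε : ℝ} (hε : 0 < ε) :
    0 ≤ energy ε γ := by
  linarith [AC.length_sub_log_le_energy h hε, AC.log_norm_sub_le h, AC.length_pos h]

theorem AC.length_le {γ : ℝ → Plane} (h : γ ∈ AC) {ε : ℝ} (hε : 0 < ε) :
    length γ ≤ 2 * energy ε γ := by
  linarith [AC.length_sub_log_le_energy h hε, AC.log_norm_sub_le h, AC.length_pos h]

/-- The logarithm repels the end points: bounded energy bounds the chord, hence the length, from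
below. -/
theorem AC.exp_neg_le_length {γ : ℝ → Plane} (h : γ ∈ AC) {ε : ℝ} (hε : 0 < ε) :
    Real.exp (-energy ε γ) ≤ length γ := by
  refine le_trans ?_ (AC.norm_sub_le_length h)
  rw [← Real.le_log_iff_exp_le (AC.norm_sub_pos h)]
  linarith [AC.length_sub_log_le_energy h hε, AC.length_pos h]

theorem AC.integral_turn_sq_le {γ : ℝ → Plane} (h : γ ∈ AC) {ε : ℝ} (hε : 0 < ε) :
    ∫ s in (0 : ℝ)..1, turn γ s ^ 2 ≤ 2 / ε * energy ε γ * length γ := by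
  have hL := AC.length_pos h
  have h1 := AC.energy_eq h ε
  have h2 := AC.log_norm_sub_le h
  have h3 : ε / 2 * ((∫ s in (0 : ℝ)..1, turn γ s ^ 2) / length γ) ≤ energy ε γ := by linarith
  have h4 : ∫ s in (0 : ℝ)..1, turn γ s ^ 2 =
      2 / ε * (ε / 2 * ((∫ s in (0 : ℝ)..1, turn γ s ^ 2) / length γ)) * length γ := by
    field_simp
  rw [h4]
  gcongr

theorem dissipation_self (γ : ℝ → Plane) : dissipation γ γ = 0 := by
  simp [dissipation]

theorem dissipation_nonneg {γ γ' : ℝ → Plane} (h : γ ∈ AC) (h' : γ' ∈ AC) :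
    0 ≤ dissipation γ γ' := by
  have hL := AC.length_pos h
  have hL' := AC.length_pos h'
  have nn : ∀ f : ℝ → ℝ, 0 ≤ ∫ s in (0 : ℝ)..1, f s ^ 2 := fun f =>
    intervalIntegral.integral_nonneg zero_le_one fun s _ => sq_nonneg _
  have := nn fun s => ⟪γ s - γ' s, rot (ds γ' s)⟫
  have := nn fun s => ⟪γ s - γ' s, rot (ds γ s)⟫
  rw [dissipation]
  positivity

theorem AC.mem_ACAngle_self {γ : ℝ → Plane} (h : γ ∈ AC) : γ ∈ ACAngle γ :=
  ⟨h, fun _ _ => real_inner_self_nonneg⟩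

namespace IsStepMinimizers

variable {ε τ : ℝ} {γ₀ : ℝ → Plane} {c : ℕ → ℝ → Plane}

theorem mem_AC (hc : IsStepMinimizers ε τ γ₀ c) (h₀ : γ₀ ∈ AC) (n : ℕ) : c n ∈ AC := by
  cases n with
  | zero => rw [hc.1]; exact h₀
  | succ n => exact (hc.2 n).1.1

/-- The previous curve is itself a competitor, with zero dissipation. -/
theorem energy_add_dissipation_le (hc : IsStepMinimizers ε τ γ₀ c) (h₀ : γ₀ ∈ AC) (n : ℕ) :
    energy ε (c (n + 1)) + 1 / τ * dissipation (c (n + 1)) (c n) ≤ energy ε (c n) := by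
  have := (hc.2 n).2 (AC.mem_ACAngle_self (hc.mem_AC h₀ n))
  simpa [stepFunctional, dissipation_self] using this

theorem energy_le (hc : IsStepMinimizers ε τ γ₀ c) (hτ : 0 < τ) (h₀ : γ₀ ∈ AC) (n : ℕ) :
    energy ε (c n) ≤ energy ε γ₀ := by
  induction n with
  | zero => rw [hc.1]
  | succ n ih =>
    have h1 := hc.energy_add_dissipation_le h₀ n
    have h2 := dissipation_nonneg (hc.mem_AC h₀ (n + 1)) (hc.mem_AC h₀ n)
    have h3 : 0 ≤ 1 / τ * dissipation (c (n + 1)) (c n) := by positivity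
    linarith

end IsStepMinimizers

/-- For small time steps the angle constraint is never active. -/
theorem exists_timeStep_bound {ε : ℝ} (hε : 0 < ε) {γ₀ : ℝ → Plane} (h₀ : γ₀ ∈ AC) :
    ∃ τ₀ : ℝ, 0 < τ₀ ∧ ∀ τ : ℝ, 0 < τ → τ < τ₀ → ∀ c : ℕ → ℝ → Plane,
      IsStepMinimizers ε τ γ₀ c → ∀ n, ∀ s ∈ I, 0 < ⟪ds (c (n + 1)) s, ds (c n) s⟫ := by
  set E := energy ε γ₀ with hE
  have hE0 : 0 < E := by linarith [AC.length_le h₀ hε, AC.length_pos h₀]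
  obtain ⟨ρ, hρ, H⟩ := exists_dissipation_bound (m := Real.exp (-E)) (M := 2 * E)
    (K := 2 / ε * E * (2 * E)) (Real.exp_pos _) (by positivity) (by positivity)
  -- Each step dissipates at most `τ * E`, because the energy lies between `0` and `E`. All bounds
  -- are uniform in `n`, so the threshold does not depend on the time horizon.
  refine ⟨ρ / E, by positivity, fun τ hτ hττ c hc n => ?_⟩
  have hAC := hc.mem_AC h₀
  have hen := hc.energy_le hτ h₀
  have hm : ∀ n, Real.exp (-E) ≤ length (c n) := fun n =>
    (Real.exp_le_exp.2 (neg_le_neg (hen n))).trans (AC.exp_neg_le_length (hAC n) hε)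
  have hM : ∀ n, length (c n) ≤ 2 * E := fun n =>
    (AC.length_le (hAC n) hε).trans (by linarith [hen n])
  have hK : ∀ n, ∫ s in (0 : ℝ)..1, turn (c n) s ^ 2 ≤ 2 / ε * E * (2 * E) := fun n => by
    refine (AC.integral_turn_sq_le (hAC n) hε).trans ?_
    have := hen n
    have := hM n
    have := AC.length_pos (hAC n)
    gcongr
  refine H _ _ (hc.2 n).1 (hAC n) (hm _) (hm _) (hM _) (hM _) (hK _) (hK _) ?_
  have h1 := hc.energy_add_dissipation_le h₀ n
  have h2 := AC.energy_nonneg (hAC (n + 1)) hε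
  have h3 : 1 / τ * dissipation (c (n + 1)) (c n) ≤ E := by linarith [hen n]
  rw [one_div, inv_mul_le_iff₀ hτ] at h3
  refine h3.trans ?_
  rw [lt_div_iff₀ hE0] at hττ
  exact hττ.le

/-! ### Variations that preserve constant speed -/

/-- Differentiation under the integral sign for jointly continuous integrands. -/
theorem hasDerivAt_integral_of_continuous {E : Type*} [NormedAddCommGroup E] [NormedSpace ℝ E]
    {F F' : ℝ → ℝ → E} (hF : Continuous fun p : ℝ × ℝ => F p.1 p.2)
    (hF' : Continuous fun p : ℝ × ℝ => F' p.1 p.2)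
    (hd : ∀ δ s, HasDerivAt (fun δ => F δ s) (F' δ s) δ) (a b δ₀ : ℝ) :
    HasDerivAt (fun δ => ∫ s in a..b, F δ s) (∫ s in a..b, F' δ₀ s) δ₀ := by
  have hcF : ∀ δ, Continuous (F δ) := fun δ => hF.comp (by fun_prop : Continuous fun s => (δ, s))
  have hcF' : ∀ δ, Continuous (F' δ) := fun δ => hF'.comp (by fun_prop : Continuous fun s => (δ, s))
  obtain ⟨C, hC⟩ := (isCompact_Icc.prod (isCompact_uIcc (a := a) (b := b))).exists_bound_of_continuousOn
    (s := Icc (δ₀ - 1) (δ₀ + 1) ×ˢ uIcc a b) hF'.continuousOn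
  refine (intervalIntegral.hasDerivAt_integral_of_dominated_loc_of_deriv_le
    (s := Icc (δ₀ - 1) (δ₀ + 1)) (bound := fun _ => C)
    (Icc_mem_nhds (by linarith) (by linarith))
    (Filter.Eventually.of_forall fun δ => (hcF δ).aestronglyMeasurable)
    ((hcF δ₀).intervalIntegrable _ _) (hcF' δ₀).aestronglyMeasurable ?_
    intervalIntegrable_const (Filter.Eventually.of_forall fun s _ δ _ => hd δ s)).2
  exact Filter.Eventually.of_forall fun s hs δ hδ => hC (δ, s) ⟨hδ, uIoc_subset_uIcc hs⟩

/-- The tangent field `T` stretched by `1 + δ lam` and rotated by the angle `δ α`. -/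
noncomputable def tangentVar (T : ℝ → Plane) (α : ℝ → ℝ) (lam δ s : ℝ) : Plane :=
  (1 + δ * lam) • (Real.cos (δ * α s) • T s + Real.sin (δ * α s) • rot (T s))

/-- The derivative of `tangentVar` with respect to `δ`. -/
noncomputable def tangentVarDeriv (T : ℝ → Plane) (α : ℝ → ℝ) (lam δ s : ℝ) : Plane :=
  (1 + δ * lam) • ((-(Real.sin (δ * α s) * α s)) • T s + (Real.cos (δ * α s) * α s) • rot (T s)) +
    lam • (Real.cos (δ * α s) • T s + Real.sin (δ * α s) • rot (T s))

/-- The curve with starting point `p + δ a` and tangent field `tangentVar T α lam δ`. -/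
noncomputable def curveVar (T : ℝ → Plane) (α : ℝ → ℝ) (lam : ℝ) (p a : Plane) (δ s : ℝ) : Plane :=
  p + δ • a + ∫ r in (0 : ℝ)..s, tangentVar T α lam δ r

/-- The derivative of `curveVar` with respect to `δ`. -/
noncomputable def curveVarDeriv (T : ℝ → Plane) (α : ℝ → ℝ) (lam : ℝ) (a : Plane) (δ s : ℝ) :
    Plane :=
  a + ∫ r in (0 : ℝ)..s, tangentVarDeriv T α lam δ r

section
variable {T : ℝ → Plane} {α : ℝ → ℝ} (hT : Continuous T) (hα : Continuous α) (lam : ℝ)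
  (p a : Plane)

include hT hα in
theorem continuous_tangentVar : Continuous fun q : ℝ × ℝ => tangentVar T α lam q.1 q.2 := by
  unfold tangentVar; fun_prop

include hT hα in
theorem continuous_tangentVarDeriv :
    Continuous fun q : ℝ × ℝ => tangentVarDeriv T α lam q.1 q.2 := by
  unfold tangentVarDeriv; fun_prop

include hT hα in
theorem continuous_curveVar : Continuous fun q : ℝ × ℝ => curveVar T α lam p a q.1 q.2 := by
  have h : Continuous fun q : ℝ × ℝ => ∫ r in (0 : ℝ)..q.2, tangentVar T α lam q.1 r :=
    intervalIntegral.continuous_parametric_intervalIntegral_of_continuous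
      (f := fun (q : ℝ × ℝ) r => tangentVar T α lam q.1 r)
      ((continuous_tangentVar hT hα lam).comp
        (by fun_prop : Continuous fun z : (ℝ × ℝ) × ℝ => (z.1.1, z.2))) continuous_snd
  unfold curveVar
  fun_prop

include hT hα in
theorem continuous_curveVarDeriv :
    Continuous fun q : ℝ × ℝ => curveVarDeriv T α lam a q.1 q.2 := by
  have h : Continuous fun q : ℝ × ℝ => ∫ r in (0 : ℝ)..q.2, tangentVarDeriv T α lam q.1 r :=
    intervalIntegral.continuous_parametric_intervalIntegral_of_continuous
      (f := fun (q : ℝ × ℝ) r => tangentVarDeriv T α lam q.1 r)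
      ((continuous_tangentVarDeriv hT hα lam).comp
        (by fun_prop : Continuous fun z : (ℝ × ℝ) × ℝ => (z.1.1, z.2))) continuous_snd
  unfold curveVarDeriv
  fun_prop

theorem hasDerivAt_tangentVar (δ s : ℝ) :
    HasDerivAt (fun δ => tangentVar T α lam δ s) (tangentVarDeriv T α lam δ s) δ := by
  have h1 : HasDerivAt (fun δ : ℝ => δ * α s) (α s) δ := by
    simpa using (hasDerivAt_id δ).mul_const (α s)
  have h2 : HasDerivAt (fun δ : ℝ => 1 + δ * lam) lam δ := by
    simpa using ((hasDerivAt_id δ).mul_const lam).const_add 1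
  have := h2.smul ((h1.cos.smul_const (T s)).add (h1.sin.smul_const (rot (T s))))
  simp only [neg_mul] at this
  exact this

include hT hα in
theorem hasDerivAt_curveVar (δ s : ℝ) :
    HasDerivAt (fun δ => curveVar T α lam p a δ s) (curveVarDeriv T α lam a δ s) δ := by
  have h1 : HasDerivAt (fun δ : ℝ => p + δ • a) a δ := by
    simpa using ((hasDerivAt_id δ).smul_const a).const_add p
  exact h1.add (hasDerivAt_integral_of_continuous (continuous_tangentVar hT hα lam)
    (continuous_tangentVarDeriv hT hα lam) (hasDerivAt_tangentVar lam) 0 s δ)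

include hT hα in
theorem hasDerivAt_curveVar_param (δ s : ℝ) :
    HasDerivAt (curveVar T α lam p a δ) (tangentVar T α lam δ s) s := by
  have hc : Continuous (tangentVar T α lam δ) :=
    (continuous_tangentVar hT hα lam).comp (by fun_prop : Continuous fun s => (δ, s))
  exact (intervalIntegral.integral_hasDerivAt_right (hc.intervalIntegrable _ _)
    hc.aestronglyMeasurable.stronglyMeasurableAtFilter hc.continuousAt).const_add _

theorem tangentVar_zero (s : ℝ) : tangentVar T α lam 0 s = T s := by simp [tangentVar]

theorem tangentVarDeriv_zero (s : ℝ) :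
    tangentVarDeriv T α lam 0 s = lam • T s + α s • rot (T s) := by
  simp [tangentVarDeriv, add_comm]

theorem rot_tangentVar (δ s : ℝ) : rot (tangentVar T α lam δ s) =
    (1 + δ * lam) • (Real.cos (δ * α s) • rot (T s) - Real.sin (δ * α s) • T s) := by
  simp only [tangentVar, rot_smul, rot_add, rot_rot]
  module

theorem norm_tangentVar {δ : ℝ} (hδ : 0 ≤ 1 + δ * lam) (s : ℝ) :
    ‖tangentVar T α lam δ s‖ = (1 + δ * lam) * ‖T s‖ := by
  rw [tangentVar, norm_smul, Real.norm_eq_abs, abs_of_nonneg hδ]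
  congr 1
  rw [← sq_eq_sq₀ (norm_nonneg _) (norm_nonneg _), norm_add_sq_real, norm_smul, norm_smul,
    inner_smul_left, inner_smul_right, inner_self_rot, norm_rot, Real.norm_eq_abs,
    Real.norm_eq_abs, mul_pow, mul_pow, sq_abs, sq_abs]
  have := Real.sin_sq_add_cos_sq (δ * α s)
  linear_combination ‖T s‖ ^ 2 * this

/-- Rotating by the angle `δ α` adds `δ α'` to the turning rate; the constant stretch does not
change it. -/
theorem hasDerivWithinAt_tangentVar {β k δ s : ℝ} {S : Set ℝ} (hα' : HasDerivAt α β s)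
    (hT' : HasDerivWithinAt T (k • rot (T s)) S s) :
    HasDerivWithinAt (tangentVar T α lam δ)
      ((k + δ * β) • rot (tangentVar T α lam δ s)) S s := by
  have h1 : HasDerivWithinAt (fun s => δ * α s) (δ * β) S s :=
    (hα'.const_mul δ).hasDerivWithinAt
  have := (((h1.cos.smul hT').add (h1.sin.smul hT'.rot)).const_smul (1 + δ * lam))
  refine this.congr_deriv ?_
  rw [rot_tangentVar, rot_smul, rot_rot]
  module

end

/-- The extension of the tangent of a curve to a function on the line. -/
noncomputable def tangent (γ : ℝ → Plane) (s : ℝ) : Plane := ds γ (clamp s)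

theorem tangent_of_mem (γ : ℝ → Plane) {s : ℝ} (hs : s ∈ I) : tangent γ s = ds γ s := by
  rw [tangent, clamp_of_mem hs]

theorem AC.continuous_tangent {γ : ℝ → Plane} (h : γ ∈ AC) : Continuous (tangent γ) :=
  continuous_comp_clamp (AC.memH2 h).continuousOn_ds

section
variable {γ : ℝ → Plane} (h : γ ∈ AC) {α : ℝ → ℝ} (hα : ContDiff ℝ 1 α) {lam δ : ℝ} (a : Plane)

include h hα in
theorem AC.ds_curveVar {s : ℝ} (hs : s ∈ I) :
    ds (curveVar (tangent γ) α lam (γ 0) a δ) s = tangentVar (tangent γ) α lam δ s :=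
  ds_eq_of_hasDerivWithinAt hs (hasDerivAt_curveVar_param (AC.continuous_tangent h)
    hα.continuous lam (γ 0) a δ s).hasDerivWithinAt

include h hα in
theorem AC.ae_hasDerivWithinAt_ds_curveVar :
    ∀ᵐ s, s ∈ I → HasDerivWithinAt (ds (curveVar (tangent γ) α lam (γ 0) a δ))
      ((turn γ s + δ * deriv α s) • rot (tangentVar (tangent γ) α lam δ s)) I s := by
  filter_upwards [ae_hasDerivAt_ds (AC.memH2 h).2.1] with s hs hsI
  have h1 : HasDerivWithinAt (tangent γ) (turn γ s • rot (tangent γ s)) I s := by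
    rw [tangent_of_mem γ hsI, ← AC.ds_ds_eq h hsI]
    exact (hs hsI).hasDerivWithinAt.congr (fun t ht => tangent_of_mem γ ht)
      (tangent_of_mem γ hsI)
  exact (hasDerivWithinAt_tangentVar lam (hα.differentiable one_ne_zero s).hasDerivAt h1).congr
    (fun t ht => AC.ds_curveVar h hα a ht) (AC.ds_curveVar h hα a hsI)

include h hα in
theorem AC.norm_ds_curveVar (hδ : 0 ≤ 1 + δ * lam) {s : ℝ} (hs : s ∈ I) :
    ‖ds (curveVar (tangent γ) α lam (γ 0) a δ) s‖ = (1 + δ * lam) * length γ := by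
  rw [AC.ds_curveVar h hα a hs, norm_tangentVar lam hδ, tangent_of_mem γ hs, AC.norm_ds h hs]

include h hα in
theorem AC.length_curveVar (hδ : 0 ≤ 1 + δ * lam) :
    length (curveVar (tangent γ) α lam (γ 0) a δ) = (1 + δ * lam) * length γ := by
  rw [length, integral_congr_I fun s hs => AC.norm_ds_curveVar h hα a hδ hs]
  simp

include h hα in
-- The varied tangent combines products of `C¹` and absolutely continuous functions, and its
-- derivative has norm `(1 + δ * lam) * length γ * |turn γ + δ * deriv α|` a.e. on `I`, which is in
-- `L²`.
theorem AC.memH2_curveVar (hδ : 0 ≤ 1 + δ * lam) :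
    MemH2 (curveVar (tangent γ) α lam (γ 0) a δ) := by
  have hT := AC.continuous_tangent h
  have hV : Continuous (tangentVar (tangent γ) α lam δ) :=
    (continuous_tangentVar hT hα.continuous lam).comp (by fun_prop : Continuous fun s => (δ, s))
  have hder := hasDerivAt_curveVar_param hT hα.continuous lam (γ 0) a δ
  refine ⟨ContDiff.contDiffOn (contDiff_one_iff_deriv.2
    ⟨fun s => (hder s).differentiableAt, ?_⟩), ?_, ?_⟩
  · rw [funext fun s => (hder s).deriv]
    exact hV
  · have hTac : AbsolutelyContinuousOnInterval (tangent γ) 0 1 :=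
      absolutelyContinuousOnInterval_congr (AC.memH2 h).2.1 fun s hs =>
        (tangent_of_mem γ (by rwa [uIcc_eq_I] at hs)).symm
    have hRac : AbsolutelyContinuousOnInterval (fun s => rot (tangent γ s)) 0 1 :=
      absolutelyContinuousOnInterval_lipschitz_comp hTac rotL.lipschitz
    have hcos : AbsolutelyContinuousOnInterval (fun s => Real.cos (δ * α s)) 0 1 :=
      (contDiff_const.mul hα).cos.contDiffOn.absolutelyContinuousOnInterval
    have hsin : AbsolutelyContinuousOnInterval (fun s => Real.sin (δ * α s)) 0 1 :=
      (contDiff_const.mul hα).sin.contDiffOn.absolutelyContinuousOnInterval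
    refine absolutelyContinuousOnInterval_congr
      (((hcos.fun_smul hTac).add (hsin.fun_smul hRac)).const_smul (1 + δ * lam)) fun s hs => ?_
    rw [AC.ds_curveVar h hα a (by rwa [uIcc_eq_I] at hs)]
    rfl
  · have hβ : MemLp (fun s => δ * deriv α s) 2 (volume.restrict I) := by
      have hc : Continuous fun s => δ * deriv α s :=
        continuous_const.mul (hα.continuous_deriv le_rfl)
      obtain ⟨C, hC⟩ := isCompact_Icc.exists_bound_of_continuousOn (s := I) hc.continuousOn
      exact MemLp.of_bound hc.aestronglyMeasurable C
        ((ae_restrict_iff' measurableSet_Icc).2 (Filter.Eventually.of_forall hC))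
    have hk := (AC.memLp_turn h).add hβ
    have hae : (fun s => (turn γ s + δ * deriv α s) • rot (tangentVar (tangent γ) α lam δ s))
        =ᵐ[volume.restrict I] ds (ds (curveVar (tangent γ) α lam (γ 0) a δ)) := by
      refine (ae_restrict_iff' measurableSet_Icc).2 ?_
      filter_upwards [AC.ae_hasDerivWithinAt_ds_curveVar h hα a (lam := lam) (δ := δ)] with s hs hsI
      exact (ds_eq_of_hasDerivWithinAt hsI (hs hsI)).symm
    refine MemLp.ae_eq hae ?_
    refine (hk.const_mul ((1 + δ * lam) * length γ)).mono
      (hk.aestronglyMeasurable.smul (continuous_rot.comp hV).aestronglyMeasurable) ?_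
    refine (ae_restrict_iff' measurableSet_Icc).2 (Filter.Eventually.of_forall fun s hs => ?_)
    rw [norm_smul, norm_rot, norm_tangentVar lam hδ, tangent_of_mem γ hs, AC.norm_ds h hs,
      norm_mul, mul_comm, Real.norm_of_nonneg (mul_nonneg hδ (AC.length_pos h).le)]
    rfl

include h hα in
theorem AC.curveVar_mem (hδ : 0 ≤ 1 + δ * lam)
    (hne : curveVar (tangent γ) α lam (γ 0) a δ 0 ≠ curveVar (tangent γ) α lam (γ 0) a δ 1) :
    curveVar (tangent γ) α lam (γ 0) a δ ∈ AC :=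
  ⟨AC.memH2_curveVar h hα a hδ, fun s hs => by
    rw [AC.norm_ds_curveVar h hα a hδ hs, AC.length_curveVar h hα a hδ], hne⟩

include h hα in
-- An exact quadratic polynomial in `δ`. The bending term can thus be differentiated although `turn
-- γ` is so far only in `L²`, beyond the reach of `hasDerivAt_integral_of_continuous`.
theorem AC.integral_turn_sq_curveVar (hδ : 0 < 1 + δ * lam) :
    ∫ s in (0 : ℝ)..1, turn (curveVar (tangent γ) α lam (γ 0) a δ) s ^ 2 =
      (∫ s in (0 : ℝ)..1, turn γ s ^ 2) + 2 * δ * (∫ s in (0 : ℝ)..1, turn γ s * deriv α s) +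
        δ ^ 2 * ∫ s in (0 : ℝ)..1, deriv α s ^ 2 := by
  have hL := AC.length_pos h
  have hc : Continuous (deriv α) := hα.continuous_deriv le_rfl
  have i1 := AC.intervalIntegrable_turn_sq h zero_mem_I one_mem_I
  have i2 : IntervalIntegrable (fun s => turn γ s * deriv α s) volume 0 1 :=
    (AC.intervalIntegrable_turn h zero_mem_I one_mem_I).mul_continuousOn hc.continuousOn
  have i3 : IntervalIntegrable (fun s => deriv α s ^ 2) volume 0 1 :=
    (hc.pow 2).intervalIntegrable _ _
  rw [← intervalIntegral.integral_const_mul, ← intervalIntegral.integral_const_mul,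
    ← intervalIntegral.integral_add i1 (i2.const_mul _),
    ← intervalIntegral.integral_add (i1.add (i2.const_mul _)) (i3.const_mul _)]
  refine intervalIntegral.integral_congr_ae ?_
  filter_upwards [AC.ae_hasDerivWithinAt_ds_curveVar h hα a (lam := lam) (δ := δ)] with s hs hs1
  have hsI : s ∈ I := by
    rw [← uIcc_eq_I]; exact uIoc_subset_uIcc hs1
  have hn : ‖tangentVar (tangent γ) α lam δ s‖ = (1 + δ * lam) * length γ := by
    rw [norm_tangentVar lam hδ.le, tangent_of_mem γ hsI, AC.norm_ds h hsI]
  have e : turn (curveVar (tangent γ) α lam (γ 0) a δ) s = turn γ s + δ * deriv α s := by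
    rw [turn, ds_eq_of_hasDerivWithinAt hsI (hs hsI), AC.ds_curveVar h hα a hsI,
      AC.length_curveVar h hα a hδ.le, inner_smul_left, real_inner_self_eq_norm_sq, norm_rot, hn]
    simp only [conj_trivial]
    field_simp
  rw [e]
  ring

include h in
theorem AC.curveVar_zero {s : ℝ} (hs : s ∈ I) :
    curveVar (tangent γ) α lam (γ 0) a 0 s = γ s := by
  have e : ∫ r in (0 : ℝ)..s, tangentVar (tangent γ) α lam 0 r = ∫ r in (0 : ℝ)..s, ds γ r :=
    intervalIntegral.integral_congr fun r hr => by
      simp only [tangentVar_zero, tangent_of_mem γ (uIcc_subset_I zero_mem_I hs hr)]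
  rw [curveVar, e, integral_eq_sub_of_hasDerivWithinAt_I
    (fun s hs => (AC.memH2 h).hasDerivWithinAt hs) (AC.memH2 h).continuousOn_ds zero_mem_I hs]
  simp

end

/-! ### First variation of the step functional -/

theorem length_congr {γ₁ γ₂ : ℝ → Plane} (h : EqOn γ₁ γ₂ I) : length γ₁ = length γ₂ :=
  integral_congr_I fun s hs => by rw [ds_congr h hs]

/-- Needed because the variation at `δ = 0` reproduces `γ` on `I` only, not as a function on the
line. -/
theorem stepFunctional_congr {γ₁ γ₂ : ℝ → Plane} (h : EqOn γ₁ γ₂ I) (ε τ : ℝ) (γ' : ℝ → Plane) :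
    stepFunctional ε τ γ₁ γ' = stepFunctional ε τ γ₂ γ' := by
  have h1 := ds_congr h
  have h2 := ds_congr h1
  have e1 : energy ε γ₁ = energy ε γ₂ := by
    rw [energy, energy, length_congr h, h zero_mem_I, h one_mem_I,
      integral_congr_I fun s hs => by rw [curvature, h1 hs, h2 hs, ← curvature]]
  have e2 : dissipation γ₁ γ' = dissipation γ₂ γ' := by
    rw [dissipation, dissipation, length_congr h, h zero_mem_I, h one_mem_I,
      integral_congr_I (f := fun s => ⟪γ₁ s - γ' s, rot (ds γ' s)⟫ ^ 2)
        (g := fun s => ⟪γ₂ s - γ' s, rot (ds γ' s)⟫ ^ 2) fun s hs => by simp only [h hs],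
      integral_congr_I (f := fun s => ⟪γ₁ s - γ' s, rot (ds γ₁ s)⟫ ^ 2)
        (g := fun s => ⟪γ₂ s - γ' s, rot (ds γ₂ s)⟫ ^ 2) fun s hs => by
          simp only [h hs, h1 hs]]
  rw [stepFunctional, stepFunctional, e1, e2]

/-- The value of the step functional along the family `curveVar`. -/
noncomputable def stepVar (ε τ : ℝ) (γ γ' : ℝ → Plane) (α : ℝ → ℝ) (lam : ℝ) (a : Plane)
    (δ : ℝ) : ℝ :=
  (1 + δ * lam) * length γ +
    ε / 2 * (((∫ s in (0 : ℝ)..1, turn γ s ^ 2) + 2 * δ * (∫ s in (0 : ℝ)..1, turn γ s * deriv α s) +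
        δ ^ 2 * ∫ s in (0 : ℝ)..1, deriv α s ^ 2) / ((1 + δ * lam) * length γ)) -
    1 / 2 * Real.log (‖curveVar (tangent γ) α lam (γ 0) a δ 1 -
      curveVar (tangent γ) α lam (γ 0) a δ 0‖ ^ 2) +
    1 / τ * (1 / (4 * length γ') * (∫ s in (0 : ℝ)..1,
        ⟪curveVar (tangent γ) α lam (γ 0) a δ s - γ' (clamp s), rot (tangent γ' s)⟫ ^ 2) +
      1 / (4 * ((1 + δ * lam) * length γ)) * (∫ s in (0 : ℝ)..1,
        ⟪curveVar (tangent γ) α lam (γ 0) a δ s - γ' (clamp s),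
          rot (tangentVar (tangent γ) α lam δ s)⟫ ^ 2) +
      1 / 2 * ‖curveVar (tangent γ) α lam (γ 0) a δ 0 - γ' 0‖ ^ 2 +
      1 / 2 * ‖curveVar (tangent γ) α lam (γ 0) a δ 1 - γ' 1‖ ^ 2)

/-- The right-hand side is explicit in `δ`: extending by `clamp` makes the dissipation integrands
jointly continuous on the plane, and the logarithm of the squared norm is readily differentiated. -/
theorem AC.stepFunctional_curveVar {γ : ℝ → Plane} (h : γ ∈ AC) (γ' : ℝ → Plane) {α : ℝ → ℝ}
    (hα : ContDiff ℝ 1 α) (ε τ : ℝ) {lam δ : ℝ} (a : Plane) (hδ : 0 < 1 + δ * lam)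
    (hne : curveVar (tangent γ) α lam (γ 0) a δ 0 ≠ curveVar (tangent γ) α lam (γ 0) a δ 1) :
    stepFunctional ε τ (curveVar (tangent γ) α lam (γ 0) a δ) γ' =
      stepVar ε τ γ γ' α lam a δ := by
  have hG := AC.curveVar_mem h hα a hδ.le hne
  rw [stepFunctional, AC.energy_eq hG, AC.length_curveVar h hα a hδ.le,
    AC.integral_turn_sq_curveVar h hα a hδ, dissipation, AC.length_curveVar h hα a hδ.le, stepVar,
    Real.log_pow]
  congr 1
  · push_cast
    ring
  · congr 4
    · congr 1
      exact integral_congr_I fun s hs => by simp only [clamp_of_mem hs, tangent_of_mem γ' hs]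
    · congr 1
      exact integral_congr_I fun s hs => by
        simp only [clamp_of_mem hs, AC.ds_curveVar h hα a hs]

/-- The first variation of the step functional in direction of the vector field `X` along `γ`,
whose derivative is `Y = lam γ_s + α R γ_s`. -/
noncomputable def stepVarDeriv (ε τ : ℝ) (γ γ' : ℝ → Plane) (α : ℝ → ℝ) (lam : ℝ)
    (X Y : ℝ → Plane) : ℝ :=
  lam * length γ +
    ε / 2 * ((2 * (∫ s in (0 : ℝ)..1, turn γ s * deriv α s) -
      lam * ∫ s in (0 : ℝ)..1, turn γ s ^ 2) / length γ) -
    ⟪γ 1 - γ 0, X 1 - X 0⟫ / ‖γ 1 - γ 0‖ ^ 2 +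
    1 / τ * (1 / (4 * length γ') * (∫ s in (0 : ℝ)..1,
        2 * ⟪γ (clamp s) - γ' (clamp s), rot (tangent γ' s)⟫ * ⟪X s, rot (tangent γ' s)⟫) +
      (1 / (4 * length γ) * (∫ s in (0 : ℝ)..1,
        2 * ⟪γ (clamp s) - γ' (clamp s), rot (tangent γ s)⟫ *
          (⟪γ (clamp s) - γ' (clamp s), rot (Y s)⟫ + ⟪X s, rot (tangent γ s)⟫)) -
        lam / (4 * length γ) *
          ∫ s in (0 : ℝ)..1, ⟪γ (clamp s) - γ' (clamp s), rot (tangent γ s)⟫ ^ 2) +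
      ⟪γ 0 - γ' 0, X 0⟫ + ⟪γ 1 - γ' 1, X 1⟫)

theorem hasDerivAt_integral_inner_rot_sq {G X V Y : ℝ → ℝ → Plane} {g : ℝ → Plane}
    (hG : Continuous fun q : ℝ × ℝ => G q.1 q.2) (hX : Continuous fun q : ℝ × ℝ => X q.1 q.2)
    (hV : Continuous fun q : ℝ × ℝ => V q.1 q.2) (hY : Continuous fun q : ℝ × ℝ => Y q.1 q.2)
    (hg : Continuous g) (dG : ∀ δ s, HasDerivAt (fun δ => G δ s) (X δ s) δ)
    (dV : ∀ δ s, HasDerivAt (fun δ => V δ s) (Y δ s) δ) (δ₀ : ℝ) :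
    HasDerivAt (fun δ => ∫ s in (0 : ℝ)..1, ⟪G δ s - g s, rot (V δ s)⟫ ^ 2)
      (∫ s in (0 : ℝ)..1, 2 * ⟪G δ₀ s - g s, rot (V δ₀ s)⟫ *
        (⟪G δ₀ s - g s, rot (Y δ₀ s)⟫ + ⟪X δ₀ s, rot (V δ₀ s)⟫)) δ₀ := by
  refine hasDerivAt_integral_of_continuous
    (F := fun δ s => ⟪G δ s - g s, rot (V δ s)⟫ ^ 2)
    (F' := fun δ s => 2 * ⟪G δ s - g s, rot (V δ s)⟫ *
      (⟪G δ s - g s, rot (Y δ s)⟫ + ⟪X δ s, rot (V δ s)⟫)) (by fun_prop) (by fun_prop)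
    (fun δ s => ?_) 0 1 δ₀
  have := (((dG δ s).sub_const (g s)).inner ℝ (dV δ s).rot).pow 2
  refine this.congr_deriv ?_
  simp

theorem hasDerivAt_stepVar {γ γ' : ℝ → Plane} (h : γ ∈ AC) (h' : γ' ∈ AC) {α : ℝ → ℝ}
    (hα : ContDiff ℝ 1 α) (ε τ lam : ℝ) (a : Plane) :
    HasDerivAt (stepVar ε τ γ γ' α lam a)
      (stepVarDeriv ε τ γ γ' α lam (curveVarDeriv (tangent γ) α lam a 0)
        (tangentVarDeriv (tangent γ) α lam 0)) 0 := by
  have hL := AC.length_pos h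
  have hT := AC.continuous_tangent h
  have hU := AC.continuous_tangent h'
  have hg : Continuous fun s => γ' (clamp s) := continuous_comp_clamp (AC.memH2 h').continuousOn
  have hG := continuous_curveVar hT hα.continuous lam (γ 0) a
  have hX := continuous_curveVarDeriv hT hα.continuous lam a
  have hV := continuous_tangentVar hT hα.continuous lam
  have hY := continuous_tangentVarDeriv hT hα.continuous lam
  have dG := hasDerivAt_curveVar hT hα.continuous lam (γ 0) a
  have dV := hasDerivAt_tangentVar (T := tangent γ) (α := α) lam
  have G0 : ∀ s ∈ I, curveVar (tangent γ) α lam (γ 0) a 0 s = γ s := fun s hs =>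
    AC.curveVar_zero h a hs
  set G := curveVar (tangent γ) α lam (γ 0) a with hGdef
  set X := curveVarDeriv (tangent γ) α lam a
  set V := tangentVar (tangent γ) α lam with hVdef
  set Y := tangentVarDeriv (tangent γ) α lam
  have V0 : ∀ s, V 0 s = tangent γ s := fun s => tangentVar_zero lam s
  have dlen : HasDerivAt (fun δ : ℝ => (1 + δ * lam) * length γ) (lam * length γ) 0 := by
    simpa using (((hasDerivAt_id (0 : ℝ)).mul_const lam).const_add 1).mul_const (length γ)
  have d1 : HasDerivAt (fun δ => ∫ s in (0 : ℝ)..1, ⟪G δ s - γ' (clamp s), rot (tangent γ' s)⟫ ^ 2)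
      (∫ s in (0 : ℝ)..1, 2 * ⟪G 0 s - γ' (clamp s), rot (tangent γ' s)⟫ *
        ⟪X 0 s, rot (tangent γ' s)⟫) 0 := by
    have := hasDerivAt_integral_inner_rot_sq (V := fun _ s => tangent γ' s) (Y := fun _ _ => 0)
      hG hX (by fun_prop) continuous_const hg dG (fun δ s => hasDerivAt_const _ _) 0
    have hz : rot 0 = 0 := rotL.map_zero
    simpa only [hz, inner_zero_right, zero_add] using this
  have d2 : HasDerivAt (fun δ => ∫ s in (0 : ℝ)..1, ⟪G δ s - γ' (clamp s), rot (V δ s)⟫ ^ 2)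
      (∫ s in (0 : ℝ)..1, 2 * ⟪G 0 s - γ' (clamp s), rot (V 0 s)⟫ *
        (⟪G 0 s - γ' (clamp s), rot (Y 0 s)⟫ + ⟪X 0 s, rot (V 0 s)⟫)) 0 :=
    hasDerivAt_integral_inner_rot_sq hG hX hV hY hg dG dV 0
  have dbend : HasDerivAt (fun δ : ℝ => (∫ s in (0 : ℝ)..1, turn γ s ^ 2) +
      2 * δ * (∫ s in (0 : ℝ)..1, turn γ s * deriv α s) +
      δ ^ 2 * ∫ s in (0 : ℝ)..1, deriv α s ^ 2)
      (2 * ∫ s in (0 : ℝ)..1, turn γ s * deriv α s) 0 := by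
    have e1 := ((hasDerivAt_id (0 : ℝ)).const_mul 2).mul_const
      (∫ s in (0 : ℝ)..1, turn γ s * deriv α s)
    have e2 := ((hasDerivAt_id (0 : ℝ)).pow 2).mul_const (∫ s in (0 : ℝ)..1, deriv α s ^ 2)
    refine ((e1.const_add (∫ s in (0 : ℝ)..1, turn γ s ^ 2)).add e2).congr_deriv ?_
    simp
  have dw := ((dG 0 1).sub (dG 0 0)).norm_sq
  have hw0 : ‖G 0 1 - G 0 0‖ ^ 2 ≠ 0 := by
    rw [G0 1 one_mem_I, G0 0 zero_mem_I]
    exact (pow_pos (AC.norm_sub_pos h) 2).ne'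
  have dlog := (dw.log hw0).const_mul (1 / 2)
  have dend0 := (((dG 0 0).sub_const (γ' 0)).norm_sq).const_mul (1 / 2)
  have dend1 := (((dG 0 1).sub_const (γ' 1)).norm_sq).const_mul (1 / 2)
  have dinv : HasDerivAt (fun δ : ℝ => 1 / (4 * ((1 + δ * lam) * length γ)))
      (-(lam / (4 * length γ))) 0 := by
    have := (hasDerivAt_const (0 : ℝ) (1 : ℝ)).div (dlen.const_mul 4) (by simp [hL.ne'])
    refine this.congr_deriv ?_
    simp only [zero_mul, add_zero, one_mul]
    field_simp
    ring
  have dtot := ((dlen.add ((dbend.div dlen (by simp [hL.ne'])).const_mul (ε / 2))).sub dlog).add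
    (((((d1.const_mul (1 / (4 * length γ'))).add (dinv.mul d2)).add dend0).add dend1).const_mul
      (1 / τ))
  have c1 : ∫ s in (0 : ℝ)..1, 2 * ⟪G 0 s - γ' (clamp s), rot (tangent γ' s)⟫ *
        ⟪X 0 s, rot (tangent γ' s)⟫ = ∫ s in (0 : ℝ)..1,
        2 * ⟪γ (clamp s) - γ' (clamp s), rot (tangent γ' s)⟫ * ⟪X 0 s, rot (tangent γ' s)⟫ :=
    integral_congr_I fun s hs => by simp only [G0 s hs, clamp_of_mem hs]
  have c2 : ∫ s in (0 : ℝ)..1, 2 * ⟪G 0 s - γ' (clamp s), rot (V 0 s)⟫ *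
        (⟪G 0 s - γ' (clamp s), rot (Y 0 s)⟫ + ⟪X 0 s, rot (V 0 s)⟫) = ∫ s in (0 : ℝ)..1,
        2 * ⟪γ (clamp s) - γ' (clamp s), rot (tangent γ s)⟫ *
          (⟪γ (clamp s) - γ' (clamp s), rot (Y 0 s)⟫ + ⟪X 0 s, rot (tangent γ s)⟫) :=
    integral_congr_I fun s hs => by simp only [G0 s hs, clamp_of_mem hs, V0]
  have c3 : ∫ s in (0 : ℝ)..1, ⟪G 0 s - γ' (clamp s), rot (V 0 s)⟫ ^ 2 =
      ∫ s in (0 : ℝ)..1, ⟪γ (clamp s) - γ' (clamp s), rot (tangent γ s)⟫ ^ 2 :=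
    integral_congr_I fun s hs => by simp only [G0 s hs, clamp_of_mem hs, V0]
  refine dtot.congr_deriv ?_
  rw [c1, c2, c3, G0 1 one_mem_I, G0 0 zero_mem_I, stepVarDeriv]
  simp only [zero_mul, add_zero, one_mul, mul_zero, Pi.sub_apply, G0 1 one_mem_I, G0 0 zero_mem_I,
    ne_eq, OfNat.ofNat_ne_zero, not_false_eq_true, zero_pow]
  have hn := (AC.norm_sub_pos h).ne'
  have e1 : ∀ P Q : ℝ, (2 * P * length γ - Q * (lam * length γ)) / length γ ^ 2 =
      (2 * P - lam * Q) / length γ := fun P Q => by field_simp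
  rw [e1]
  ring

/-- The Euler-Lagrange equation of the step functional, if the angle constraint is not active. -/
theorem stepVarDeriv_eq_zero {γ γ' : ℝ → Plane} (h : γ ∈ ACAngle γ') (h' : γ' ∈ AC) {ε τ : ℝ}
    (hmin : IsMinOn (fun ζ => stepFunctional ε τ ζ γ') (ACAngle γ') γ)
    (hangle : ∀ s ∈ I, 0 < ⟪ds γ s, ds γ' s⟫) {α : ℝ → ℝ} (hα : ContDiff ℝ 1 α) (lam : ℝ)
    (a : Plane) :
    stepVarDeriv ε τ γ γ' α lam
      (fun s => a + ∫ r in (0 : ℝ)..s, (lam • tangent γ r + α r • rot (tangent γ r)))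
      (fun s => lam • tangent γ s + α s • rot (tangent γ s)) = 0 := by
  have hγ := h.1
  have hT := AC.continuous_tangent hγ
  have hU := AC.continuous_tangent h'
  have hd := hasDerivAt_stepVar hγ h' hα ε τ lam a
  have eY : tangentVarDeriv (tangent γ) α lam 0 =
      fun s => lam • tangent γ s + α s • rot (tangent γ s) :=
    funext fun s => tangentVarDeriv_zero lam s
  have eX : curveVarDeriv (tangent γ) α lam a 0 =
      fun s => a + ∫ r in (0 : ℝ)..s, (lam • tangent γ r + α r • rot (tangent γ r)) := by
    funext s
    simp only [curveVarDeriv, eY]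
  rw [eX, eY] at hd
  refine IsLocalMin.hasDerivAt_eq_zero ?_ hd
  have ev1 : ∀ᶠ δ in nhds (0 : ℝ), 0 < 1 + δ * lam :=
    ContinuousAt.eventually_lt continuousAt_const
      (by fun_prop : Continuous fun δ : ℝ => 1 + δ * lam).continuousAt (by simp)
  have hG := continuous_curveVar hT hα.continuous lam (γ 0) a
  have hV := continuous_tangentVar hT hα.continuous lam
  have ev2 : ∀ᶠ δ in nhds (0 : ℝ), curveVar (tangent γ) α lam (γ 0) a δ 0 ≠
      curveVar (tangent γ) α lam (γ 0) a δ 1 := by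
    have hc : ∀ s : ℝ, Continuous fun δ => curveVar (tangent γ) α lam (γ 0) a δ s := fun s =>
      hG.comp (by fun_prop : Continuous fun δ : ℝ => (δ, s))
    refine ((hc 0).continuousAt).ne_iff_eventually_ne ((hc 1).continuousAt) |>.1 ?_
    rw [AC.curveVar_zero hγ a zero_mem_I, AC.curveVar_zero hγ a one_mem_I]
    exact hγ.2.2
  -- A strict inequality on a compact interval survives small `δ`, so the varied curves are
  -- competitors for both signs of `δ`.
  have ev3 : ∀ᶠ δ in nhds (0 : ℝ), ∀ s ∈ I,
      0 < ⟪tangentVar (tangent γ) α lam δ s, tangent γ' s⟫ := by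
    refine isCompact_Icc.eventually_forall_of_forall_eventually fun s hs => ?_
    refine ContinuousAt.eventually_lt continuousAt_const (Continuous.continuousAt (by fun_prop)) ?_
    simp only [tangentVar_zero, tangent_of_mem γ hs, tangent_of_mem γ' hs]
    exact hangle s hs
  have e0 : stepFunctional ε τ γ γ' = stepVar ε τ γ γ' α lam a 0 := by
    rw [← AC.stepFunctional_curveVar hγ γ' hα ε τ a (by simp) ev2.self_of_nhds]
    exact stepFunctional_congr (fun s hs => (AC.curveVar_zero hγ a hs).symm) ε τ γ'
  filter_upwards [ev1, ev2, ev3] with δ h1 h2 h3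
  rw [← e0, ← AC.stepFunctional_curveVar hγ γ' hα ε τ a h1 h2]
  refine hmin ⟨AC.curveVar_mem hγ hα a h1.le h2, fun s hs => ?_⟩
  rw [AC.ds_curveVar hγ hα a hs, ← tangent_of_mem γ' hs]
  exact (h3 s hs).le

/-! ### Integration by parts and the lemma of du Bois-Reymond -/

theorem hasDerivAt_integral_left {E : Type*} [NormedAddCommGroup E] [NormedSpace ℝ E]
    [CompleteSpace E] {f : ℝ → E} (hf : Continuous f) (b s : ℝ) :
    HasDerivAt (fun s => ∫ r in s..b, f r) (-f s) s :=
  intervalIntegral.integral_hasDerivAt_left (hf.intervalIntegrable _ _)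
    hf.aestronglyMeasurable.stronglyMeasurableAtFilter hf.continuousAt

theorem hasDerivAt_integral_right {E : Type*} [NormedAddCommGroup E] [NormedSpace ℝ E]
    [CompleteSpace E] {f : ℝ → E} (hf : Continuous f) (a s : ℝ) :
    HasDerivAt (fun s => ∫ r in a..s, f r) (f s) s :=
  intervalIntegral.integral_hasDerivAt_right (hf.intervalIntegrable _ _)
    hf.aestronglyMeasurable.stronglyMeasurableAtFilter hf.continuousAt

theorem continuous_integral_left {E : Type*} [NormedAddCommGroup E] [NormedSpace ℝ E]
    [CompleteSpace E] {f : ℝ → E} (hf : Continuous f) (b : ℝ) :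
    Continuous fun s => ∫ r in s..b, f r :=
  continuous_iff_continuousAt.2 fun s => (hasDerivAt_integral_left hf b s).continuousAt

theorem intervalIntegrable_of_continuousOn_I {E : Type*} [NormedAddCommGroup E] {f : ℝ → E}
    (hf : ContinuousOn f I) : IntervalIntegrable f volume 0 1 :=
  ContinuousOn.intervalIntegrable (by rwa [uIcc_eq_I])

/-- A linear functional of a vector field `X` on `I` and its derivative `Y` as a functional of the
initial value and the derivative. -/
theorem integral_inner_add_eq {N M X Y : ℝ → Plane} (hN : Continuous N) (hM : Continuous M)
    (hX : ∀ s ∈ I, HasDerivWithinAt X (Y s) I s) (hY : ContinuousOn Y I) (p₀ p₁ : Plane) :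
    (∫ s in (0 : ℝ)..1, (⟪N s, X s⟫ + ⟪M s, Y s⟫)) + ⟪p₀, X 0⟫ + ⟪p₁, X 1⟫ =
      ⟪(∫ s in (0 : ℝ)..1, N s) + p₀ + p₁, X 0⟫ +
        ∫ s in (0 : ℝ)..1, ⟪(∫ r in s..1, N r) + M s + p₁, Y s⟫ := by
  have hXc : ContinuousOn X I := fun s hs => (hX s hs).continuousWithinAt
  have hQ := continuous_integral_left hN 1
  have i1 : ContinuousOn (fun s => ⟪N s, X s⟫) I := hN.continuousOn.inner (𝕜 := ℝ) hXc
  have i2 : ContinuousOn (fun s => ⟪M s, Y s⟫) I := hM.continuousOn.inner (𝕜 := ℝ) hY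
  have i3 : ContinuousOn (fun s => ⟪∫ r in s..1, N r, Y s⟫) I :=
    hQ.continuousOn.inner (𝕜 := ℝ) hY
  have i4 : ContinuousOn (fun s => ⟪p₁, Y s⟫) I := continuousOn_const.inner (𝕜 := ℝ) hY
  -- Integrating by parts against the tail integral of `N`, and against the constant `p₁`, leaves
  -- only `X 0` and `Y`.
  have f1 := integral_eq_sub_of_hasDerivWithinAt_I
    (fun s hs => (hasDerivAt_integral_left hN 1 s).hasDerivWithinAt.inner ℝ (hX s hs))
    (i3.add ((hN.neg.continuousOn.inner (𝕜 := ℝ) hXc))) zero_mem_I one_mem_I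
  have f2 := integral_eq_sub_of_hasDerivWithinAt_I
    (fun s hs => (hasDerivWithinAt_const s I p₁).inner ℝ (hX s hs))
    (i4.add ((continuousOn_const.inner (𝕜 := ℝ) hXc))) zero_mem_I one_mem_I
  simp only [inner_neg_left, inner_zero_left, add_zero, intervalIntegral.integral_same,
    zero_sub, ← sub_eq_add_neg] at f1 f2
  simp only [inner_add_left]
  have j1 := intervalIntegrable_of_continuousOn_I i1
  have j2 := intervalIntegrable_of_continuousOn_I i2
  have j3 := intervalIntegrable_of_continuousOn_I i3
  have j4 := intervalIntegrable_of_continuousOn_I i4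
  rw [intervalIntegral.integral_sub j3 j1] at f1
  rw [intervalIntegral.integral_add j1 j2, intervalIntegral.integral_add (j3.add j2) j4,
    intervalIntegral.integral_add j3 j2]
  linarith

/-- The lemma of du Bois-Reymond, with natural boundary conditions. -/
theorem ae_eq_of_forall_integral_mul_deriv_add {k G : ℝ → ℝ} {κ : ℝ} (hκ : κ ≠ 0)
    (hk : IntervalIntegrable k volume 0 1) (hG : Continuous G)
    (H : ∀ α : ℝ → ℝ, ContDiff ℝ 1 α →
      κ * (∫ s in (0 : ℝ)..1, k s * deriv α s) + ∫ s in (0 : ℝ)..1, G s * α s = 0) :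
    (∫ s in (0 : ℝ)..1, G s = 0) ∧ ∀ᵐ s, s ∈ I → k s = -(∫ r in s..1, G r) / κ := by
  -- Constant `α` gives the zero mean of `G`, the source of the natural boundary condition at `0`.
  refine ⟨by simpa using H (fun _ => 1) contDiff_const, ?_⟩
  have hJ := continuous_integral_left hG 1
  set J : ℝ → ℝ := fun s => ∫ r in s..1, G r with hJdef
  have hint : IntervalIntegrable (fun s => κ * k s + J s) volume 0 1 :=
    (hk.const_mul κ).add (hJ.intervalIntegrable _ _)
  have hloc : LocallyIntegrableOn (fun s => κ * k s + J s) (Ioo (0 : ℝ) 1) :=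
    (((intervalIntegrable_iff_integrableOn_Ioc_of_le zero_le_one).1 hint).mono_set
      Ioo_subset_Ioc_self).locallyIntegrableOn
  -- Any test function `g` is allowed, not only those of mean zero: its primitive `α` vanishes at
  -- `0`, need not vanish at `1`, and the tail integral `J` vanishes there instead.
  have hz := isOpen_Ioo.ae_eq_zero_of_integral_contDiff_smul_eq_zero hloc fun g hg _ hsupp => by
    set α : ℝ → ℝ := fun s => ∫ r in (0 : ℝ)..s, g r with hα
    have dα : ∀ s, HasDerivAt α (g s) s := hasDerivAt_integral_right hg.continuous 0
    have dα' : deriv α = g := funext fun s => (dα s).deriv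
    have hα1 : ContDiff ℝ 1 α :=
      contDiff_one_iff_deriv.2 ⟨fun s => (dα s).differentiableAt, by rw [dα']; exact hg.continuous⟩
    have h1 := H α hα1
    rw [dα'] at h1
    have hz0 : α 0 = 0 := by simp [hα]
    have hz1 : J 1 = 0 := intervalIntegral.integral_same
    have h2 : ∫ s in (0 : ℝ)..1, (J s * g s - G s * α s) = J 1 * α 1 - J 0 * α 0 :=
      integral_eq_sub_of_hasDerivWithinAt_I (f := fun s => J s * α s)
        (f' := fun s => J s * g s - G s * α s)
        (fun s _ => (((hasDerivAt_integral_left hG 1 s).mul (dα s)).congr_deriv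
          (by simp only [hJdef]; ring)).hasDerivWithinAt)
        (((hJ.mul hg.continuous).sub (hG.mul hα1.continuous)).continuousOn)
        zero_mem_I one_mem_I
    have i1 : IntervalIntegrable (fun s => J s * g s) volume 0 1 :=
      (hJ.mul hg.continuous).intervalIntegrable _ _
    have i2 : IntervalIntegrable (fun s => G s * α s) volume 0 1 :=
      (hG.mul hα1.continuous).intervalIntegrable _ _
    rw [hz0, hz1, intervalIntegral.integral_sub i1 i2] at h2
    have h3 : ∫ s in (0 : ℝ)..1, g s * (κ * k s + J s) = 0 := by
      have e : ∀ s, g s * (κ * k s + J s) = κ * (k s * g s) + J s * g s := fun s => by ring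
      simp_rw [e]
      rw [intervalIntegral.integral_add
        ((hk.mul_continuousOn hg.continuous.continuousOn).const_mul κ)
        i1, intervalIntegral.integral_const_mul]
      linarith
    rw [← h3, intervalIntegral.integral_of_le zero_le_one]
    symm
    refine setIntegral_eq_integral_of_forall_compl_eq_zero fun s hs => ?_
    have : s ∉ tsupport g := fun hmem => hs (Ioo_subset_Ioc_self (hsupp hmem))
    rw [image_eq_zero_of_notMem_tsupport this]
    simp
  have h0 : ∀ᵐ s : ℝ, s ≠ 0 := by simp [ae_iff, measure_singleton]
  have h1 : ∀ᵐ s : ℝ, s ≠ 1 := by simp [ae_iff, measure_singleton]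
  filter_upwards [hz, h0, h1] with s hs n0 n1 hsI
  have := hs ⟨lt_of_le_of_ne hsI.1 n0.symm, lt_of_le_of_ne hsI.2 n1⟩
  rw [eq_div_iff hκ]
  linarith

/-! ### Balance laws and regularity of a minimizer -/

/-- The extension of the displacement of a step to a function on the line. -/
noncomputable def displacement (γ γ' : ℝ → Plane) (s : ℝ) : Plane := γ (clamp s) - γ' (clamp s)

/-- The density of the first variation of the dissipation with respect to the vector field. -/
noncomputable def forceDensity (τ : ℝ) (γ γ' : ℝ → Plane) (s : ℝ) : Plane :=
  (1 / τ * (1 / (2 * length γ')) * ⟪displacement γ γ' s, rot (tangent γ' s)⟫) •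
      rot (tangent γ' s) +
    (1 / τ * (1 / (2 * length γ)) * ⟪displacement γ γ' s, rot (tangent γ s)⟫) •
      rot (tangent γ s)

/-- The density of the first variation of the dissipation with respect to the derivative of the
vector field. -/
noncomputable def stressDensity (τ : ℝ) (γ γ' : ℝ → Plane) (s : ℝ) : Plane :=
  (-(1 / τ * (1 / (2 * length γ)) * ⟪displacement γ γ' s, rot (tangent γ s)⟫)) •
    rot (displacement γ γ' s)

/-- The first variation of the logarithmic part of the energy. -/
noncomputable def endForce (γ : ℝ → Plane) : Plane := (1 / ‖γ 1 - γ 0‖ ^ 2) • (γ 1 - γ 0)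

/-- The first variation of the step functional with respect to the length, for a fixed vector
field. -/
noncomputable def lengthForce (ε τ : ℝ) (γ γ' : ℝ → Plane) : ℝ :=
  length γ - ε / (2 * length γ) * (∫ s in (0 : ℝ)..1, turn γ s ^ 2) -
    1 / τ * (1 / (4 * length γ)) *
      ∫ s in (0 : ℝ)..1, ⟪displacement γ γ' s, rot (tangent γ s)⟫ ^ 2

section
variable {γ γ' : ℝ → Plane} (h : γ ∈ AC) (h' : γ' ∈ AC) (τ : ℝ)

include h h' in
theorem continuous_displacement : Continuous (displacement γ γ') :=
  (continuous_comp_clamp (AC.memH2 h).continuousOn).sub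
    (continuous_comp_clamp (AC.memH2 h').continuousOn)

include h h' in
theorem continuous_forceDensity : Continuous (forceDensity τ γ γ') := by
  have := continuous_displacement h h'
  have := AC.continuous_tangent h
  have := AC.continuous_tangent h'
  unfold forceDensity
  fun_prop

include h h' in
theorem continuous_stressDensity : Continuous (stressDensity τ γ γ') := by
  have := continuous_displacement h h'
  have := AC.continuous_tangent h
  unfold stressDensity
  fun_prop

include h h' in
-- Collects the variation into a multiple of `lam`, a term in `α'` and a linear functional of `X`
-- and `Y`, the form required by `integral_inner_add_eq`.
theorem stepVarDeriv_eq (ε : ℝ) (α : ℝ → ℝ) (lam : ℝ) {X Y : ℝ → Plane} (hX : Continuous X)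
    (hY : Continuous Y) :
    stepVarDeriv ε τ γ γ' α lam X Y =
      lam * lengthForce ε τ γ γ' + ε / length γ * (∫ s in (0 : ℝ)..1, turn γ s * deriv α s) +
      ((∫ s in (0 : ℝ)..1, (⟪forceDensity τ γ γ' s, X s⟫ + ⟪stressDensity τ γ γ' s, Y s⟫)) +
        ⟪(1 / τ) • (γ 0 - γ' 0) + endForce γ, X 0⟫ +
        ⟪(1 / τ) • (γ 1 - γ' 1) - endForce γ, X 1⟫) := by
  have hw := continuous_displacement h h'
  have hT := AC.continuous_tangent h
  have hU := AC.continuous_tangent h'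
  have hL := AC.length_pos h
  have hL' := AC.length_pos h'
  have hn := (AC.norm_sub_pos h).ne'
  have e1 : ∀ s, ⟪forceDensity τ γ γ' s, X s⟫ + ⟪stressDensity τ γ γ' s, Y s⟫ =
      1 / τ * (1 / (4 * length γ')) *
        (2 * ⟪displacement γ γ' s, rot (tangent γ' s)⟫ * ⟪X s, rot (tangent γ' s)⟫) +
      1 / τ * (1 / (4 * length γ)) * (2 * ⟪displacement γ γ' s, rot (tangent γ s)⟫ *
          (⟪displacement γ γ' s, rot (Y s)⟫ + ⟪X s, rot (tangent γ s)⟫)) := by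
    intro s
    rw [real_inner_comm (X s) (forceDensity τ γ γ' s)]
    simp only [forceDensity, stressDensity, inner_add_right, inner_smul_right, inner_smul_left,
      conj_trivial, inner_rot_left (displacement γ γ' s) (Y s)]
    have t1 : 1 / (2 * length γ') = 2 * (1 / (4 * length γ')) := by field_simp; norm_num
    have t2 : 1 / (2 * length γ) = 2 * (1 / (4 * length γ)) := by field_simp; norm_num
    rw [t1, t2]
    ring
  simp_rw [e1]
  rw [intervalIntegral.integral_add (Continuous.intervalIntegrable (by fun_prop) _ _)
    (Continuous.intervalIntegrable (by fun_prop) _ _), intervalIntegral.integral_const_mul,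
    intervalIntegral.integral_const_mul, stepVarDeriv, lengthForce, endForce]
  simp only [← displacement.eq_1, inner_add_left, inner_sub_left, inner_sub_right,
    inner_smul_left, conj_trivial]
  field_simp
  ring

end

theorem hasDerivWithinAt_integral_I {E : Type*} [NormedAddCommGroup E] [NormedSpace ℝ E]
    [CompleteSpace E] {f : ℝ → E} (hf : ContinuousOn f I) {s : ℝ} (hs : s ∈ I) :
    HasDerivWithinAt (fun s => ∫ r in (0 : ℝ)..s, f r) (f s) I s := by
  have h1 := (hasDerivAt_integral_right (continuous_comp_clamp hf) 0 s).hasDerivWithinAt (s := I)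
  rw [clamp_of_mem hs] at h1
  have e : ∀ t ∈ I, ∫ r in (0 : ℝ)..t, f r = ∫ r in (0 : ℝ)..t, f (clamp r) := fun t ht =>
    intervalIntegral.integral_congr fun r hr => by
      simp only [clamp_of_mem (uIcc_subset_I zero_mem_I ht hr)]
  exact h1.congr e (e s hs)

/-- The sum of all forces, integrated along the curve: the tension of the curve. -/
noncomputable def tension (τ : ℝ) (γ γ' : ℝ → Plane) (s : ℝ) : Plane :=
  (∫ r in s..1, forceDensity τ γ γ' r) + stressDensity τ γ γ' s +
    ((1 / τ) • (γ 1 - γ' 1) - endForce γ)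

theorem continuous_tension {γ γ' : ℝ → Plane} (h : γ ∈ AC) (h' : γ' ∈ AC) (τ : ℝ) :
    Continuous (tension τ γ γ') :=
  ((continuous_integral_left (continuous_forceDensity h h' τ) 1).add
    (continuous_stressDensity h h' τ)).add continuous_const

section
variable {γ γ' : ℝ → Plane} {ε τ : ℝ} (h : γ ∈ ACAngle γ') (h' : γ' ∈ AC) (hε : 0 < ε)
  (hmin : IsMinOn (fun ζ => stepFunctional ε τ ζ γ') (ACAngle γ') γ)
  (hangle : ∀ s ∈ I, 0 < ⟪ds γ s, ds γ' s⟫)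

include h h' hmin hangle in
-- Expressing the field through its initial value `a` and its derivative makes `a`, `lam` and `α`
-- independent, so that each can be tested separately.
theorem weak_balance {α : ℝ → ℝ} (hα : ContDiff ℝ 1 α) (lam : ℝ) (a : Plane) :
    lam * lengthForce ε τ γ γ' + ε / length γ * (∫ s in (0 : ℝ)..1, turn γ s * deriv α s) +
      (⟪(∫ s in (0 : ℝ)..1, forceDensity τ γ γ' s) + ((1 / τ) • (γ 0 - γ' 0) + endForce γ) +
        ((1 / τ) • (γ 1 - γ' 1) - endForce γ), a⟫ +
      ∫ s in (0 : ℝ)..1,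
        ⟪tension τ γ γ' s, lam • tangent γ s + α s • rot (tangent γ s)⟫) = 0 := by
  have hT := AC.continuous_tangent h.1
  have hY : Continuous fun s => lam • tangent γ s + α s • rot (tangent γ s) := by
    have := hα.continuous
    fun_prop
  have hX : ∀ s, HasDerivAt
      (fun s => a + ∫ r in (0 : ℝ)..s, (lam • tangent γ r + α r • rot (tangent γ r)))
      (lam • tangent γ s + α s • rot (tangent γ s)) s := fun s =>
    (hasDerivAt_integral_right hY 0 s).const_add a
  have e1 := stepVarDeriv_eq_zero h h' hmin hangle hα lam a
  rw [stepVarDeriv_eq h.1 h' τ ε α lam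
    (continuous_iff_continuousAt.2 fun s => (hX s).continuousAt) hY,
    integral_inner_add_eq (continuous_forceDensity h.1 h' τ) (continuous_stressDensity h.1 h' τ)
      (fun s _ => (hX s).hasDerivWithinAt) hY.continuousOn] at e1
  simp only [intervalIntegral.integral_same, add_zero] at e1
  exact e1

include h h' hmin hangle in
-- Translation invariance of the test directions: take the total force itself as `a`.
theorem force_balance :
    (∫ s in (0 : ℝ)..1, forceDensity τ γ γ' s) + ((1 / τ) • (γ 0 - γ' 0) + endForce γ) +
        ((1 / τ) • (γ 1 - γ' 1) - endForce γ) = 0 := by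
  have := weak_balance h h' hmin hangle (α := fun _ => 0) contDiff_const 0
    ((∫ s in (0 : ℝ)..1, forceDensity τ γ γ' s) + ((1 / τ) • (γ 0 - γ' 0) + endForce γ) +
        ((1 / τ) • (γ 1 - γ' 1) - endForce γ))
  simp only [zero_mul, deriv_const, mul_zero, intervalIntegral.integral_zero, zero_smul, add_zero,
    inner_zero_right, zero_add] at this
  exact inner_self_eq_zero.1 this

include h h' hmin hangle in
theorem length_balance :
    lengthForce ε τ γ γ' + ∫ s in (0 : ℝ)..1, ⟪tension τ γ γ' s, tangent γ s⟫ = 0 := by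
  simpa using weak_balance h h' hmin hangle (α := fun _ => 0) contDiff_const 1 0

include h h' hε hmin hangle in
-- The rotational directions (`lam = 0`, `a = 0`) have the form treated by the du Bois-Reymond
-- lemma, with `κ = ε / length γ`.
theorem turn_ae_eq : (∫ s in (0 : ℝ)..1, ⟪tension τ γ γ' s, rot (tangent γ s)⟫ = 0) ∧
    ∀ᵐ s, s ∈ I → turn γ s =
      -(∫ r in s..1, ⟪tension τ γ γ' r, rot (tangent γ r)⟫) / (ε / length γ) := by
  have hL := AC.length_pos h.1
  have hT := AC.continuous_tangent h.1
  have hZ := continuous_tension h.1 h' τ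
  refine ae_eq_of_forall_integral_mul_deriv_add (by positivity)
    (AC.intervalIntegrable_turn h.1 zero_mem_I one_mem_I) (by fun_prop) fun α hα => ?_
  have := weak_balance h h' hmin hangle hα 0 0
  simpa [inner_smul_right, mul_comm (⟪_, _⟫)] using this

include h h' hε hmin hangle in
/-- Minimizers are twice continuously differentiable. -/
theorem turn_eq {s : ℝ} (hs : s ∈ I) : turn γ s =
      -(∫ r in s..1, ⟪tension τ γ γ' r, rot (tangent γ r)⟫) / (ε / length γ) := by
  have hL := AC.length_pos h.1
  have hT := AC.continuous_tangent h.1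
  have hZ := continuous_tension h.1 h' τ
  set k : ℝ → ℝ := fun s =>
    -(∫ r in s..1, ⟪tension τ γ γ' r, rot (tangent γ r)⟫) / (ε / length γ) with hk
  have hkc : Continuous k :=
    (continuous_integral_left (by fun_prop) 1).neg.div_const _
  -- The tangent is an integral whose integrand may be changed on a null set. With the continuous
  -- representative `k` it becomes differentiable at every point, which upgrades the a.e. formula.
  have e : ∀ t ∈ I, ds γ t = ds γ 0 + ∫ r in (0 : ℝ)..t, k r • rot (tangent γ r) := by
    intro t ht
    rw [eq_comm, ← eq_sub_iff_add_eq', AC.ds_sub_ds h.1 zero_mem_I ht]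
    refine intervalIntegral.integral_congr_ae ?_
    filter_upwards [(turn_ae_eq h h' hε hmin hangle).2] with r hr hrt
    have hrI := uIcc_subset_I zero_mem_I ht (uIoc_subset_uIcc hrt)
    rw [hr hrI, tangent_of_mem γ hrI]
  have hder : HasDerivWithinAt (ds γ) (k s • rot (ds γ s)) I s := by
    have h1 : HasDerivAt (fun t => ds γ 0 + ∫ r in (0 : ℝ)..t, k r • rot (tangent γ r))
        (k s • rot (tangent γ s)) s :=
      (hasDerivAt_integral_right (by fun_prop) 0 s).const_add _
    rw [tangent_of_mem γ hs] at h1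
    exact h1.hasDerivWithinAt.congr e (e s hs)
  rw [turn, ds_eq_of_hasDerivWithinAt hs hder, inner_smul_left, real_inner_self_eq_norm_sq,
    norm_rot, AC.norm_ds h.1 hs]
  exact mul_div_cancel_right₀ (k s) (by positivity)

include h h' hε hmin hangle in
-- This extra derivative is what allows a multiple of `turn γ` to appear in the rotation `α` of a
-- test direction.
theorem hasDerivWithinAt_turn {s : ℝ} (hs : s ∈ I) : HasDerivWithinAt (turn γ)
    (⟪tension τ γ γ' s, rot (tangent γ s)⟫ / (ε / length γ)) I s := by
  have hT := AC.continuous_tangent h.1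
  have hZ := continuous_tension h.1 h' τ
  have h1 := ((hasDerivAt_integral_left
    (f := fun r => ⟪tension τ γ γ' r, rot (tangent γ r)⟫) (by fun_prop) 1 s).neg.div_const
      (ε / length γ)).hasDerivWithinAt (s := I)
  rw [neg_neg] at h1
  exact h1.congr (fun t ht => turn_eq h h' hε hmin hangle ht) (turn_eq h h' hε hmin hangle hs)

include h h' hε hmin hangle in
theorem hasDerivWithinAt_ds {s : ℝ} (hs : s ∈ I) :
    HasDerivWithinAt (ds γ) (turn γ s • rot (ds γ s)) I s := by
  have hL := AC.length_pos h.1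
  have hkc : ContinuousOn (turn γ) I := fun s hs =>
    (hasDerivWithinAt_turn h h' hε hmin hangle hs).continuousWithinAt
  have h1 := (hasDerivWithinAt_integral_I (f := fun r => turn γ r • rot (ds γ r))
    (hkc.smul (continuous_rot.comp_continuousOn (AC.memH2 h.1).continuousOn_ds)) hs).const_add
    (ds γ 0)
  have e : ∀ t ∈ I, ds γ t = ds γ 0 + ∫ r in (0 : ℝ)..t, turn γ r • rot (ds γ r) := by
    intro t ht
    rw [← AC.ds_sub_ds h.1 zero_mem_I ht]
    abel
  exact h1.congr e (e s hs)

include h h' hε hmin hangle in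
-- With `turn_zero`, the natural boundary conditions: free ends carry no bending moment. They remove
-- the boundary terms when `turn γ` is integrated by parts.
theorem turn_one : turn γ 1 = 0 := by
  rw [turn_eq h h' hε hmin hangle one_mem_I]; simp

include h h' hε hmin hangle in
theorem turn_zero : turn γ 0 = 0 := by
  rw [turn_eq h h' hε hmin hangle zero_mem_I, (turn_ae_eq h h' hε hmin hangle).1]; simp

include h h' hε hmin hangle in
/-- The Euler-Lagrange equation, tested with a vector field `X` with derivative
`lam γ_s + α R γ_s`. -/
theorem strong_balance {α α' : ℝ → ℝ} {lam : ℝ} {X Y : ℝ → Plane}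
    (hα : ∀ s ∈ I, HasDerivWithinAt α (α' s) I s) (hα' : ContinuousOn α' I)
    (hX : ∀ s ∈ I, HasDerivWithinAt X (Y s) I s)
    (hY : ∀ s ∈ I, Y s = lam • ds γ s + α s • rot (ds γ s)) :
    lam * lengthForce ε τ γ γ' + ε / length γ * (∫ s in (0 : ℝ)..1, turn γ s * α' s) +
      ((∫ s in (0 : ℝ)..1, (⟪forceDensity τ γ γ' s, X s⟫ + ⟪stressDensity τ γ γ' s, Y s⟫)) +
        ⟪(1 / τ) • (γ 0 - γ' 0) + endForce γ, X 0⟫ +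
        ⟪(1 / τ) • (γ 1 - γ' 1) - endForce γ, X 1⟫) = 0 := by
  have hL := AC.length_pos h.1
  have hT := AC.continuous_tangent h.1
  have hZ := continuous_tension h.1 h' τ
  have hdT := (AC.memH2 h.1).continuousOn_ds
  have hαc : ContinuousOn α I := fun s hs => (hα s hs).continuousWithinAt
  have hYc : ContinuousOn Y I := by
    refine ContinuousOn.congr ?_ hY
    fun_prop
  rw [integral_inner_add_eq (continuous_forceDensity h.1 h' τ) (continuous_stressDensity h.1 h' τ)
    hX hYc, force_balance h h' hmin hangle, inner_zero_left, zero_add]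
  have e1 : ∫ s in (0 : ℝ)..1, ⟪(∫ r in s..1, forceDensity τ γ γ' r) + stressDensity τ γ γ' s +
      ((1 / τ) • (γ 1 - γ' 1) - endForce γ), Y s⟫ =
      lam * (∫ s in (0 : ℝ)..1, ⟪tension τ γ γ' s, tangent γ s⟫) +
        ∫ s in (0 : ℝ)..1, ⟪tension τ γ γ' s, rot (tangent γ s)⟫ * α s := by
    rw [← intervalIntegral.integral_const_mul, ← intervalIntegral.integral_add
      (intervalIntegrable_of_continuousOn_I (by fun_prop))
      (intervalIntegrable_of_continuousOn_I (by fun_prop))]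
    refine integral_congr_I fun s hs => ?_
    simp only [hY s hs, inner_add_right, inner_smul_right, tangent_of_mem γ hs, tension]
    ring
  -- The integrand is the derivative of `turn γ * α`, whose boundary values vanish whatever `α` is.
  -- Rotation thus balances, and the part proportional to `lam` is `length_balance`.
  have e2 : ∫ s in (0 : ℝ)..1, (⟪tension τ γ γ' s, rot (tangent γ s)⟫ / (ε / length γ) * α s +
      turn γ s * α' s) = 0 := by
    have hkc : ContinuousOn (turn γ) I := fun s hs =>
      (hasDerivWithinAt_turn h h' hε hmin hangle hs).continuousWithinAt
    rw [integral_eq_sub_of_hasDerivWithinAt_I (f := fun s => turn γ s * α s)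
      (fun s hs => (hasDerivWithinAt_turn h h' hε hmin hangle hs).mul (hα s hs)) (by fun_prop)
      zero_mem_I one_mem_I, turn_one h h' hε hmin hangle, turn_zero h h' hε hmin hangle]
    ring
  have hkc : ContinuousOn (turn γ) I := fun s hs =>
    (hasDerivWithinAt_turn h h' hε hmin hangle hs).continuousWithinAt
  have e3 : ∀ s, ⟪tension τ γ γ' s, rot (tangent γ s)⟫ / (ε / length γ) * α s =
      (length γ / ε) * (⟪tension τ γ γ' s, rot (tangent γ s)⟫ * α s) := fun s => by field_simp
  simp_rw [e3] at e2
  rw [intervalIntegral.integral_add (intervalIntegrable_of_continuousOn_I (by fun_prop))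
    (intervalIntegrable_of_continuousOn_I (by fun_prop)),
    intervalIntegral.integral_const_mul] at e2
  have e4 := length_balance h h' hmin hangle
  rw [e1]
  have e5 : ε / length γ * (∫ s in (0 : ℝ)..1, turn γ s * α' s) =
      -∫ s in (0 : ℝ)..1, ⟪tension τ γ γ' s, rot (tangent γ s)⟫ * α s := by
    rw [eq_neg_of_add_eq_zero_right e2]
    field_simp
  rw [e5]
  linear_combination lam * e4

end

/-! ### Tangential correction of test fields and the Euler-Lagrange identity -/

/-- Together with `P₁_one`: the tangential correction does not move the end points, so the end-point
terms see only `η`. -/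
theorem P₁_zero (γ η : ℝ → Plane) : P₁ γ η 0 = 0 := by simp [P₁]

theorem P₁_one (γ η : ℝ → Plane) : P₁ γ η 1 = 0 := by simp [P₁]

theorem hasDerivWithinAt_P₁ {γ η : ℝ → Plane} (hγ : ContinuousOn (ds γ) I)
    (hη : ContinuousOn (ds η) I) {s : ℝ} (hs : s ∈ I) :
    HasDerivWithinAt (P₁ γ η) (P₂ γ η s) I s := by
  have h1 := hasDerivWithinAt_integral_I (f := fun r => ⟪ds γ r, ds η r⟫) (hγ.inner hη) hs
  have h2 := (((hasDerivWithinAt_id s I).mul_const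
    (∫ r in (0 : ℝ)..1, ⟪ds γ r, ds η r⟫)).sub h1).const_mul (1 / length γ ^ 2)
  rw [one_mul] at h2
  exact h2

section
variable {γ γ' η : ℝ → Plane} {τ : ℝ}

/-- The dissipation and error terms are the first variation of the dissipation in direction of
`η + P₁ γ_s`. -/
theorem dissipationTerm_add_errorTerm (h : γ ∈ AC) (h' : γ' ∈ AC)
    (hη : ContinuousOn η I) (hη' : ContinuousOn (ds η) I) (hk : ContinuousOn (turn γ) I) :
    dissipationTerm τ γ γ' η + errorTerm τ γ γ' η =
      (∫ s in (0 : ℝ)..1, (⟪forceDensity τ γ γ' s, η s + P₁ γ η s • ds γ s⟫ +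
        ⟪stressDensity τ γ γ' s, ds η s + (P₁ γ η s • turn γ s • rot (ds γ s) +
          P₂ γ η s • ds γ s)⟫)) +
      ⟪(1 / τ) • (γ 0 - γ' 0), η 0⟫ + ⟪(1 / τ) • (γ 1 - γ' 1), η 1⟫ -
      (1 / length γ ^ 2 * ∫ s in (0 : ℝ)..1, ⟪ds γ s, ds η s⟫) *
        (1 / τ * (1 / (4 * length γ)) *
          ∫ s in (0 : ℝ)..1, ⟪displacement γ γ' s, rot (tangent γ s)⟫ ^ 2) := by
  have hL := AC.length_pos h
  have cT := (AC.memH2 h).continuousOn_ds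
  have cU := (AC.memH2 h').continuousOn_ds
  have cγ := (AC.memH2 h).continuousOn
  have cγ' := (AC.memH2 h').continuousOn
  have cP : ContinuousOn (P₁ γ η) I := fun s hs =>
    (hasDerivWithinAt_P₁ cT hη' hs).continuousWithinAt
  have cP2 : ContinuousOn (P₂ γ η) I := by
    unfold P₂
    fun_prop
  have cv : ContinuousOn (vel τ γ γ') I := by
    unfold vel
    fun_prop
  have e1 : ∫ s in (0 : ℝ)..1, (⟪forceDensity τ γ γ' s, η s + P₁ γ η s • ds γ s⟫ +
        ⟪stressDensity τ γ γ' s, ds η s + (P₁ γ η s • turn γ s • rot (ds γ s) +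
          P₂ γ η s • ds γ s)⟫) =
      1 / (2 * length γ') * (∫ s in (0 : ℝ)..1,
        ⟪vel τ γ γ' s, rot (ds γ' s)⟫ * ⟪rot (ds γ' s), η s⟫) +
      1 / (2 * length γ') * (∫ s in (0 : ℝ)..1,
        ⟪vel τ γ γ' s, rot (ds γ' s)⟫ * ⟪rot (ds γ' s), P₁ γ η s • ds γ s⟫) +
      (1 / (2 * length γ) * (∫ s in (0 : ℝ)..1,
        ⟪vel τ γ γ' s, rot (ds γ s)⟫ * ⟪rot (ds γ s), η s⟫) +
      1 / (2 * length γ) * (∫ s in (0 : ℝ)..1, ⟪vel τ γ γ' s, rot (ds γ s)⟫ *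
        ⟪γ s - γ' s, P₁ γ η s • rot (turn γ s • rot (ds γ s)) + P₂ γ η s • rot (ds γ s) +
          rot (ds η s)⟫)) := by
    have i1 := intervalIntegrable_of_continuousOn_I (f := fun s =>
      ⟪vel τ γ γ' s, rot (ds γ' s)⟫ * ⟪rot (ds γ' s), η s⟫) (by fun_prop)
    have i2 := intervalIntegrable_of_continuousOn_I (f := fun s =>
      ⟪vel τ γ γ' s, rot (ds γ' s)⟫ * ⟪rot (ds γ' s), P₁ γ η s • ds γ s⟫) (by fun_prop)
    have i3 := intervalIntegrable_of_continuousOn_I (f := fun s =>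
      ⟪vel τ γ γ' s, rot (ds γ s)⟫ * ⟪rot (ds γ s), η s⟫) (by fun_prop)
    have i4 := intervalIntegrable_of_continuousOn_I (f := fun s =>
      ⟪vel τ γ γ' s, rot (ds γ s)⟫ * ⟪γ s - γ' s, P₁ γ η s • rot (turn γ s • rot (ds γ s)) +
        P₂ γ η s • rot (ds γ s) + rot (ds η s)⟫) (by fun_prop)
    rw [← intervalIntegral.integral_const_mul, ← intervalIntegral.integral_const_mul,
      ← intervalIntegral.integral_const_mul, ← intervalIntegral.integral_const_mul,
      ← intervalIntegral.integral_add (i1.const_mul _) (i2.const_mul _),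
      ← intervalIntegral.integral_add (i3.const_mul _) (i4.const_mul _),
      ← intervalIntegral.integral_add ((i1.const_mul _).add (i2.const_mul _))
        ((i3.const_mul _).add (i4.const_mul _))]
    refine integral_congr_I fun s hs => ?_
    simp only [forceDensity, stressDensity, displacement, tangent_of_mem γ hs,
      tangent_of_mem γ' hs, clamp_of_mem hs, vel, inner_add_left, inner_add_right,
      inner_smul_left, inner_smul_right, conj_trivial, inner_rot_self, rot_smul,
      inner_rot_left (γ s - γ' s)]
    ring
  have e2 : ∫ s in (0 : ℝ)..1, ⟪vel τ γ γ' s, rot (ds γ s)⟫ * ⟪γ s - γ' s, rot (ds γ s)⟫ =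
      1 / τ * ∫ s in (0 : ℝ)..1, ⟪displacement γ γ' s, rot (tangent γ s)⟫ ^ 2 := by
    rw [← intervalIntegral.integral_const_mul]
    refine integral_congr_I fun s hs => ?_
    simp only [displacement, tangent_of_mem γ hs, clamp_of_mem hs, vel, inner_smul_left,
      conj_trivial]
    ring
  have e3 : ∫ s in (0 : ℝ)..1, ⟪vel τ γ γ' s, rot (ds γ s)⟫ *
        ⟪γ s - γ' s, P₁ γ η s • rot (ds (ds γ) s) + P₂ γ η s • rot (ds γ s) +
          rot (ds η s)⟫ =
      ∫ s in (0 : ℝ)..1, ⟪vel τ γ γ' s, rot (ds γ s)⟫ *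
        ⟪γ s - γ' s, P₁ γ η s • rot (turn γ s • rot (ds γ s)) + P₂ γ η s • rot (ds γ s) +
          rot (ds η s)⟫ := integral_congr_I fun s hs => by simp only [AC.ds_ds_eq h hs]
  rw [e1, dissipationTerm, errorTerm, e2, e3, vel, vel]
  have e4 : 1 / (4 * length γ ^ 3) = 1 / length γ ^ 2 * (1 / (4 * length γ)) := by field_simp
  rw [e4]
  ring

/-- The energy term is the first variation of the energy in direction of `η + P₁ γ_s`. -/
theorem energyTerm_eq (ε : ℝ) {k' : ℝ → ℝ} (h : γ ∈ AC)
    (hη' : ContinuousOn (ds η) I) (hη'' : ContinuousOn (ds (ds η)) I)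
    (hk : ∀ s ∈ I, HasDerivWithinAt (turn γ) (k' s) I s) (hk' : ContinuousOn k' I) :
    energyTerm ε γ η =
      (1 / length γ ^ 2 * ∫ s in (0 : ℝ)..1, ⟪ds γ s, ds η s⟫) *
        (length γ - ε / (2 * length γ) * ∫ s in (0 : ℝ)..1, turn γ s ^ 2) +
      ε / length γ * (∫ s in (0 : ℝ)..1, turn γ s *
        (1 / length γ ^ 2 * (⟪ds (ds η) s, rot (ds γ s)⟫ - turn γ s * ⟪ds γ s, ds η s⟫) +
          (P₂ γ η s * turn γ s + P₁ γ η s * k' s))) -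
      ⟪endForce γ, η 1 - η 0⟫ := by
  have hL := AC.length_pos h
  have cT := (AC.memH2 h).continuousOn_ds
  have ck : ContinuousOn (turn γ) I := fun s hs => (hk s hs).continuousWithinAt
  have cP : ContinuousOn (P₁ γ η) I := fun s hs =>
    (hasDerivWithinAt_P₁ cT hη' hs).continuousWithinAt
  have cP2 : ContinuousOn (P₂ γ η) I := by
    unfold P₂
    fun_prop
  have ia := intervalIntegrable_of_continuousOn_I
    (f := fun s => turn γ s * ⟪ds (ds η) s, rot (ds γ s)⟫) (by fun_prop)
  have ib := intervalIntegrable_of_continuousOn_I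
    (f := fun s => turn γ s ^ 2 * ⟪ds γ s, ds η s⟫) (by fun_prop)
  have ic := intervalIntegrable_of_continuousOn_I
    (f := fun s => P₂ γ η s * turn γ s ^ 2) (by fun_prop)
  have id := intervalIntegrable_of_continuousOn_I
    (f := fun s => P₁ γ η s * (turn γ s * k' s)) (by fun_prop)
  have ie := intervalIntegrable_of_continuousOn_I
    (f := fun s => ⟪ds γ s, ds η s⟫) (by fun_prop)
  have ik := intervalIntegrable_of_continuousOn_I (f := fun s => turn γ s ^ 2) (by fun_prop)
  have e1 : ∫ s in (0 : ℝ)..1, (ε / length γ ^ 3 * ⟪ds (ds γ) s, ds (ds η) s⟫ +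
      1 / length γ * (1 - 3 * ε / 2 * curvature γ s ^ 2) * ⟪ds γ s, ds η s⟫) =
      ε / length γ ^ 3 * (∫ s in (0 : ℝ)..1, turn γ s * ⟪ds (ds η) s, rot (ds γ s)⟫) +
      (1 / length γ * (∫ s in (0 : ℝ)..1, ⟪ds γ s, ds η s⟫) -
      3 * ε / (2 * length γ ^ 3) * ∫ s in (0 : ℝ)..1, turn γ s ^ 2 * ⟪ds γ s, ds η s⟫) := by
    rw [← intervalIntegral.integral_const_mul, ← intervalIntegral.integral_const_mul,
      ← intervalIntegral.integral_const_mul,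
      ← intervalIntegral.integral_sub (ie.const_mul _) (ib.const_mul _),
      ← intervalIntegral.integral_add (ia.const_mul _) ((ie.const_mul _).sub (ib.const_mul _))]
    refine integral_congr_I fun s hs => ?_
    simp only [AC.ds_ds_eq h hs, AC.curvature_eq h hs, inner_smul_left, conj_trivial,
      real_inner_comm (rot (ds γ s))]
    field_simp
  have e2 : ∫ s in (0 : ℝ)..1, turn γ s *
        (1 / length γ ^ 2 * (⟪ds (ds η) s, rot (ds γ s)⟫ - turn γ s * ⟪ds γ s, ds η s⟫) +
          (P₂ γ η s * turn γ s + P₁ γ η s * k' s)) =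
      1 / length γ ^ 2 * (∫ s in (0 : ℝ)..1, turn γ s * ⟪ds (ds η) s, rot (ds γ s)⟫) -
      1 / length γ ^ 2 * (∫ s in (0 : ℝ)..1, turn γ s ^ 2 * ⟪ds γ s, ds η s⟫) +
      ((∫ s in (0 : ℝ)..1, P₂ γ η s * turn γ s ^ 2) +
        ∫ s in (0 : ℝ)..1, P₁ γ η s * (turn γ s * k' s)) := by
    rw [← intervalIntegral.integral_const_mul, ← intervalIntegral.integral_const_mul,
      ← intervalIntegral.integral_sub (ia.const_mul _) (ib.const_mul _),
      ← intervalIntegral.integral_add ic id,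
      ← intervalIntegral.integral_add ((ia.const_mul _).sub (ib.const_mul _)) (ic.add id)]
    exact integral_congr_I fun s _ => by ring
  -- Integrating the derivative of `P₁ * turn ^ 2` eliminates `k'`, which does not occur in the
  -- energy term.
  have e3 : (∫ s in (0 : ℝ)..1, P₂ γ η s * turn γ s ^ 2) +
      2 * ∫ s in (0 : ℝ)..1, P₁ γ η s * (turn γ s * k' s) = 0 := by
    rw [← intervalIntegral.integral_const_mul,
      ← intervalIntegral.integral_add ic (id.const_mul _),
      integral_eq_sub_of_hasDerivWithinAt_I (f := fun s => P₁ γ η s * turn γ s ^ 2)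
        (fun s hs => ((hasDerivWithinAt_P₁ cT hη' hs).mul ((hk s hs).pow 2)).congr_deriv
          (by simp only [Pi.pow_apply]; push_cast; ring))
        (by fun_prop) zero_mem_I one_mem_I, P₁_one, P₁_zero]
    ring
  -- After `e5`, half of this remains: its constant part cancels the bending contribution of the
  -- length variation, and its other part raises the coefficient of `turn ^ 2 * ⟪γ_s, η_s⟫` from `1`
  -- to `3 / 2`.
  have e4 : ∫ s in (0 : ℝ)..1, P₂ γ η s * turn γ s ^ 2 =
      1 / length γ ^ 2 * (∫ s in (0 : ℝ)..1, ⟪ds γ s, ds η s⟫) *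
        (∫ s in (0 : ℝ)..1, turn γ s ^ 2) -
      1 / length γ ^ 2 * ∫ s in (0 : ℝ)..1, turn γ s ^ 2 * ⟪ds γ s, ds η s⟫ := by
    rw [← intervalIntegral.integral_const_mul
        (1 / length γ ^ 2 * ∫ s in (0 : ℝ)..1, ⟪ds γ s, ds η s⟫),
      ← intervalIntegral.integral_const_mul (1 / length γ ^ 2)
        (fun s => turn γ s ^ 2 * ⟪ds γ s, ds η s⟫),
      ← intervalIntegral.integral_sub (ik.const_mul _) (ib.const_mul _)]
    refine integral_congr_I fun s _ => ?_
    simp only [P₂]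
    ring
  have e5 : ∫ s in (0 : ℝ)..1, P₁ γ η s * (turn γ s * k' s) =
      -(∫ s in (0 : ℝ)..1, P₂ γ η s * turn γ s ^ 2) / 2 := by linarith only [e3]
  rw [energyTerm, e1, e2, e5, e4, endForce]
  field_simp
  ring

/-- `P₂`, the derivative of `P₁`, replaces the tangential stretch `⟪γ_s, η_s⟫ / L²` of `η` by its
mean. The field `η + P₁ γ_s` is thus a constant stretch plus a rotation of the tangent, and
`strong_balance` applies. -/
theorem energyTerm_add_dissipationTerm_add_errorTerm {ε : ℝ} (h : γ ∈ ACAngle γ') (h' : γ' ∈ AC)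
    (hε : 0 < ε) (hmin : IsMinOn (fun ζ => stepFunctional ε τ ζ γ') (ACAngle γ') γ)
    (hangle : ∀ s ∈ I, 0 < ⟪ds γ s, ds γ' s⟫) (hη : ContDiffOn ℝ 2 η I) :
    energyTerm ε γ η + dissipationTerm τ γ γ' η + errorTerm τ γ γ' η = 0 := by
  have hL := AC.length_pos h.1
  have hT := AC.continuous_tangent h.1
  have hZ := continuous_tension h.1 h' τ
  have cT := (AC.memH2 h.1).continuousOn_ds
  have hη1 : ContDiffOn ℝ 1 (ds η) I := hη.derivWithin uniqueDiffOn_I (by norm_num)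
  have cη1 : ContinuousOn (ds η) I := hη1.continuousOn
  have cη2 : ContinuousOn (ds (ds η)) I := hη1.continuousOn_derivWithin uniqueDiffOn_I le_rfl
  have dη : ∀ s ∈ I, HasDerivWithinAt η (ds η s) I s := fun s hs =>
    (hη.differentiableOn two_ne_zero s hs).hasDerivWithinAt
  have dη1 : ∀ s ∈ I, HasDerivWithinAt (ds η) (ds (ds η) s) I s := fun s hs =>
    (hη1.differentiableOn one_ne_zero s hs).hasDerivWithinAt
  have dk := fun s (hs : s ∈ I) => hasDerivWithinAt_turn h h' hε hmin hangle hs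
  have dT := fun s (hs : s ∈ I) => hasDerivWithinAt_ds h h' hε hmin hangle hs
  have ck : ContinuousOn (turn γ) I := fun s hs => (dk s hs).continuousWithinAt
  set k' : ℝ → ℝ := fun s => ⟪tension τ γ γ' s, rot (tangent γ s)⟫ / (ε / length γ) with hk'
  have ck' : ContinuousOn k' I := by
    have : Continuous k' := by fun_prop
    exact this.continuousOn
  have dP := fun s (hs : s ∈ I) => hasDerivWithinAt_P₁ cT cη1 hs
  have cP : ContinuousOn (P₁ γ η) I := fun s hs => (dP s hs).continuousWithinAt
  have cP2 : ContinuousOn (P₂ γ η) I := by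
    unfold P₂
    fun_prop
  set lam := 1 / length γ ^ 2 * ∫ s in (0 : ℝ)..1, ⟪ds γ s, ds η s⟫ with hlam
  have key := strong_balance h h' hε hmin hangle (lam := lam)
    (α := fun s => 1 / length γ ^ 2 * ⟪ds η s, rot (ds γ s)⟫ + P₁ γ η s * turn γ s)
    (α' := fun s =>
      1 / length γ ^ 2 * (⟪ds (ds η) s, rot (ds γ s)⟫ - turn γ s * ⟪ds γ s, ds η s⟫) +
        (P₂ γ η s * turn γ s + P₁ γ η s * k' s))
    (X := fun s => η s + P₁ γ η s • ds γ s)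
    (Y := fun s => ds η s + (P₁ γ η s • turn γ s • rot (ds γ s) + P₂ γ η s • ds γ s))
    (fun s hs => by
      refine ((((dη1 s hs).inner ℝ (dT s hs).rot).const_mul (1 / length γ ^ 2)).add
        ((dP s hs).mul (dk s hs))).congr_deriv ?_
      rw [rot_smul, rot_rot, inner_smul_right, inner_neg_right, real_inner_comm (ds γ s)]
      ring)
    (by fun_prop)
    (fun s hs => (dη s hs).add ((dP s hs).smul (dT s hs)))
    (fun s hs => by
      -- Split `η_s` in the frame of the tangent: `P₂` completes the tangential coefficient to
      -- `lam`, and the normal coefficient joins `P₁ * turn` to form `α`.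
      have e := norm_sq_smul_eq (ds γ s) (ds η s)
      rw [AC.norm_ds h.1 hs] at e
      have e' : ds η s = (1 / length γ ^ 2) •
          (⟪ds η s, ds γ s⟫ • ds γ s + ⟪ds η s, rot (ds γ s)⟫ • rot (ds γ s)) := by
        rw [← e, smul_smul, one_div_mul_cancel (by positivity), one_smul]
      have eP : P₂ γ η s = lam - 1 / length γ ^ 2 * ⟪ds η s, ds γ s⟫ := by
        rw [P₂, hlam, real_inner_comm (ds γ s) (ds η s)]
        ring
      rw [eP]
      nth_rewrite 1 [e']
      module)
  simp only [P₁_zero, P₁_one, zero_smul, add_zero] at key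
  rw [add_assoc, dissipationTerm_add_errorTerm h.1 h' hη.continuousOn cη1 ck,
    energyTerm_eq ε h.1 cη1 cη2 dk ck', ← hlam]
  rw [lengthForce] at key
  simp only [inner_add_left, inner_sub_left, inner_sub_right] at key ⊢
  linear_combination key

end

/-! ### Passage to the time interpolation -/

theorem IsTestFunction.contDiffOn {η : ℝ → ℝ → Plane} (hη : IsTestFunction η) {t : ℝ}
    (ht : 0 ≤ t) : ContDiffOn ℝ ∞ (η t) I :=
  ContDiffOn.comp (g := fun p : ℝ × ℝ => η p.1 p.2) (f := fun s : ℝ => (t, s)) hη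
    (by fun_prop) fun _ hs => ⟨ht, hs⟩

theorem interp_of_mem {τ : ℝ} (hτ : 0 < τ) (c : ℕ → ℝ → Plane) {t : ℝ} (ht : 0 < t) :
    ∃ n : ℕ, interp τ c t = c (n + 1) ∧ interp τ c (t - τ) = c n := by
  have h1 : 0 < ⌈t / τ⌉₊ := Nat.ceil_pos.2 (div_pos ht hτ)
  refine ⟨⌈t / τ⌉₊ - 1, ?_, ?_⟩
  · rw [interp, Nat.sub_add_cancel h1]
  -- Truncated subtraction fits the convention for `t ≤ τ`: the natural ceiling of a nonpositive
  -- number is `0`, which selects `c 0`.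
  · rw [interp, sub_div, div_self hτ.ne', Nat.ceil_sub_one]

end ElasticFlow

theorem theorem2p5 (ε : ℝ) (hε : 0 < ε) (γ₀ : ℝ → ElasticFlow.Plane)
    (hγ₀ : γ₀ ∈ ElasticFlow.AC) (T : ℝ) (hT : 0 < T) :
    ∃ τ₀ : ℝ, 0 < τ₀ ∧ ∀ τ : ℝ, 0 < τ → τ < τ₀ →
      ∀ c : ℕ → ℝ → ElasticFlow.Plane, ElasticFlow.IsStepMinimizers ε τ γ₀ c →
        ∀ η : ℝ → ℝ → ElasticFlow.Plane, ElasticFlow.IsTestFunction η →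
          IntervalIntegrable (ElasticFlow.eulerLagrange ε τ c η) volume 0 T ∧
            ∫ t in (0 : ℝ)..T, ElasticFlow.eulerLagrange ε τ c η t = 0 := by
  obtain ⟨τ₀, hτ₀, H⟩ := ElasticFlow.exists_timeStep_bound hε hγ₀
  refine ⟨τ₀, hτ₀, fun τ hτ hττ c hc η hη => ?_⟩
  -- The integrand vanishes identically on `(0, T]`, which also settles integrability. The time `t =
  -- 0`, at which no minimization step is involved, lies outside the half-open interval.
  have hzero : ∀ t ∈ Set.uIoc 0 T, ElasticFlow.eulerLagrange ε τ c η t = 0 := by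
    intro t ht
    rw [Set.uIoc_of_le hT.le] at ht
    obtain ⟨n, h1, h2⟩ := ElasticFlow.interp_of_mem hτ c ht.1
    rw [ElasticFlow.eulerLagrange, h1, h2]
    exact ElasticFlow.energyTerm_add_dissipationTerm_add_errorTerm (hc.2 n).1 (hc.mem_AC hγ₀ n) hε
      (hc.2 n).2 (H τ hτ hττ c hc n) ((hη.contDiffOn ht.1.le).of_le ENat.LEInfty.out)
  constructor
  · exact (intervalIntegrable_const (c := (0 : ℝ))).congr fun t ht => (hzero t ht).symm
  · rw [intervalIntegral.integral_congr_ae (Filter.Eventually.of_forall hzero)]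
    simp
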